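/- Let $V=(V,Y,\mathbf 1,\rho)$ be a quasi-vertex operator algebra over $\mathbf C$: a vertex algebra with modes $Y(a,z)=\sum_{n\in\mathbf Z}a(n)z^{-n-1}$ and vacuum $\mathbf 1\neq 0$; a grading $V=\bigoplus_{n\in\mathbf Z}V_n$ with $\dim V_n<\infty$, $V_n=0$ for $n\ll 0$ and $a(n)b\in V_{k+\ell-n-1}$ for $a\in V_k$, $b\in V_\ell$; and a representation $\rho$ of $\mathfrak{sl}_2$ on $V$ under which $\left(\begin{smallmatrix}1/2&0\\0&-1/2\end{smallmatrix}\right),\left(\begin{smallmatrix}0&1\\0&0\end{smallmatrix}\right),\left(\begin{smallmatrix}0&0\\-1&0\end{smallmatrix}\right)$ act as operators $L(0),L(-1),L(1)$ such that $L(0)a=ka$ for $a\in V_k$, $L(-1)a=a(-2)\mathbf 1$, $(L(-1)a)(n)=-n\,a(n-1)=[L(-1),a(n)]$, and $[L(1),a(n)]=(L(1)a)(n)+(2k-n-2)a(n+1)$ for $a\in V_k$. For $\gamma=\left(\begin{smallmatrix}a&b\\c&d\end{smallmatrix}\right)\in\mathrm{SL}_2(\mathbf Z)$ and $\tau$ in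 the upper half-plane $\mathcal H$ put $j=c\tau+d$, $X=X(\gamma,\tau)=\frac{c}{c\tau+d}$ and $K(\gamma,\tau)=\exp(-c\,j\,L(1))\,j^{-2L(0)}$. For $k\in\mathbf Z$ and $f:\mathcal H\to V$ let $$(f||_k\gamma)(\tau)=j^{-k}K(\gamma,\tau)^{-1}f(\gamma\tau).$$ Let $F_NV=\bigoplus_{n\le N}V_n$. The space $Q_k(V)$ of holomorphic $V$-valued quasi-modular forms of weight $k$ consists of the holomorphic maps $f:\mathcal H\to F_NV$ (for some $N$) for which there are $s\ge 0$ and holomorphic maps $Q_0(f),\dots,Q_s(f):\mathcal H\to F_NV$ with $$(f||_k\gamma)(\tau)=\sum_{n=0}^{s}X(\gamma,\tau)^n\,Q_n(f)(\tau)\qquad(\gamma\in\mathrm{SL}_2(\mathbf Z),\ \tau\in\mathcal H),$$ and such that $f$ and all $Q_n(f)$ are holomorphic at the cusp, i.e. given by $q$-expansions in $F_NV[[q]]$, $q=e^{2\pi i\tau}$. Let $E_2,E_4,E_6$ be the Eisenstein series for $\mathrm{SL}_2(\mathbf Z)$ with constant term $1$. **Theorem.** Let $k\in\mathbf Z$ and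 $f\in Q_k(V)$. Then $f$ can be written in exactly one way as a polynomial in $E_2,E_4,E_6$ with coefficients in $V$, so that the operator $$\Lambda=\frac{12}{2\pi i}\frac{\partial}{\partial E_2}+L(1)$$ (with $L(1)$ acting on the coefficients) can be applied to $f$; $\Lambda^nf=0$ for all large $n$; and for all $\gamma\in\mathrm{SL}_2(\mathbf Z)$ and $\tau\in\mathcal H$, $$(f||_k\gamma)(\tau)=\exp(X\Lambda)f(\tau)=\sum_{n\ge 0}\frac{X(\gamma,\tau)^n}{n!}(\Lambda^nf)(\tau).$$ Consequently, if $(f||_k\gamma)(\tau)=\sum_{n=0}^{s}X(\gamma,\tau)^nQ_n(f)(\tau)$ for all $\gamma$ and $\tau$, then, with $Q_n(f)=0$ for $n>s$, one has $Q_n(f)=\frac1{n!}\Lambda^nf$ for all $n\ge 0$. -/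

import Mathlib

open scoped TensorProduct Manifold MatrixGroups
open UpperHalfPlane

noncomputable section

/- The Lie bracket on `Module.End ℂ V` is the commutator. -/
attribute [local instance 100] LieRing.ofAssociativeRing

/-! ### Quasi-vertex operator algebras -/

/-- The `n`-th mode `a(n)`, where `Y(a, z) = ∑ₙ a(n) z^{-n-1}`. A `VertexOperator` is a linear map
from `V` to Laurent series with coefficients in `V`, so `Y(a, z)` is a field by construction. -/
def vertexMode {V : Type*} [AddCommGroup V] [Module ℂ V]
    (Y : V →ₗ[ℂ] VertexOperator ℂ V) (a : V) (n : ℤ) : Module.End ℂ V :=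
  VertexOperator.ncoeff (Y a) n

/-- Vertex algebras `(V, Y, 𝟏)` over `ℂ`. The sums in the Jacobi identity are finite because
`Y(a, z)` is a field for every state `a`. -/
structure ComplexVertexAlgebra (V : Type*) [AddCommGroup V] [Module ℂ V] where
  /-- the state-field correspondence -/
  Y : V →ₗ[ℂ] VertexOperator ℂ V
  /-- the vacuum vector -/
  vac : V
  vac_ne_zero : vac ≠ 0
  creative : ∀ (a : V) (n : ℤ), 0 ≤ n → vertexMode Y a n vac = 0
  creates : ∀ a : V, vertexMode Y a (-1) vac = a
  jacobi : ∀ (a b c : V) (r s t : ℤ),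
    ∑ᶠ i : ℕ, (Ring.choose r i : ℤ) •
        vertexMode Y (vertexMode Y a (t + i) b) (r + s - i) c =
      ∑ᶠ i : ℕ, ((-1) ^ i * Ring.choose t i : ℤ) •
        (vertexMode Y a (r + t - i) (vertexMode Y b (s + i) c) -
          (t.negOnePow : ℤ) • vertexMode Y b (s + t - i) (vertexMode Y a (r + i) c))

/-- The element `diag(1/2, -1/2)` of `𝔰𝔩₂`. -/
def slEuler : LieAlgebra.SpecialLinear.sl (Fin 2) ℂ :=
  ⟨!![1 / 2, 0; 0, -1 / 2], by
    refine LinearMap.mem_ker.mpr ?_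
    rw [Matrix.traceLinearMap_apply, Matrix.trace_fin_two]
    norm_num⟩

/-- The element `(0 1; 0 0)` of `𝔰𝔩₂`. -/
def slRaise : LieAlgebra.SpecialLinear.sl (Fin 2) ℂ :=
  ⟨!![0, 1; 0, 0], by
    refine LinearMap.mem_ker.mpr ?_
    rw [Matrix.traceLinearMap_apply, Matrix.trace_fin_two]
    norm_num⟩

/-- The element `(0 0; -1 0)` of `𝔰𝔩₂`. -/
def slLower : LieAlgebra.SpecialLinear.sl (Fin 2) ℂ :=
  ⟨!![0, 0; -1, 0], by
    refine LinearMap.mem_ker.mpr ?_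
    rw [Matrix.traceLinearMap_apply, Matrix.trace_fin_two]
    norm_num⟩

/-- Quasi-vertex operator algebras `(V, Y, 𝟏, ρ)` over `ℂ`: a `ℤ`-graded vertex algebra (with
finite-dimensional graded pieces that vanish in sufficiently negative degrees) and a
representation `ρ` of `𝔰𝔩₂` on `V` by the Euler operator `L(0)`, the canonical derivation
`L(-1) : a ↦ a(-2)𝟏` and an operator `L(1)`. -/
structure QVOA (V : Type*) [AddCommGroup V] [Module ℂ V] extends ComplexVertexAlgebra V where
  /-- the graded piece `V_k`, the states of conformal degree `k` -/
  grade : ℤ → Submodule ℂ V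
  isInternal : DirectSum.IsInternal grade
  mode_mem : ∀ (k l n : ℤ) (a b : V), a ∈ grade k → b ∈ grade l →
    vertexMode Y a n b ∈ grade (k + l - n - 1)
  finiteDimensional : ∀ k, FiniteDimensional ℂ (grade k)
  exists_grade_eq_bot : ∃ n₀ : ℤ, ∀ n < n₀, grade n = ⊥
  /-- the representation of `𝔰𝔩₂` -/
  rho : LieAlgebra.SpecialLinear.sl (Fin 2) ℂ →ₗ⁅ℂ⁆ Module.End ℂ V
  rho_euler : ∀ (k : ℤ), ∀ a ∈ grade k, rho slEuler a = (k : ℂ) • a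
  rho_raise : ∀ a : V, rho slRaise a = vertexMode Y a (-2) vac
  mode_rho_raise : ∀ (a : V) (n : ℤ),
    vertexMode Y (rho slRaise a) n = -(n : ℂ) • vertexMode Y a (n - 1)
  comm_rho_raise : ∀ (a : V) (n : ℤ),
    rho slRaise * vertexMode Y a n - vertexMode Y a n * rho slRaise =
      -(n : ℂ) • vertexMode Y a (n - 1)
  comm_rho_lower : ∀ (k : ℤ), ∀ a ∈ grade k, ∀ n : ℤ,
    rho slLower * vertexMode Y a n - vertexMode Y a n * rho slLower =
      vertexMode Y (rho slLower a) n + (2 * k - n - 2 : ℂ) • vertexMode Y a (n + 1)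

/-! ### Exponentials of locally nilpotent operators -/

/-- `exp(x A) v = ∑ₙ (xⁿ / n!) Aⁿ v` for a locally nilpotent operator `A` (a finite sum). -/
def nilExpFun {V : Type*} [AddCommGroup V] [Module ℂ V] (A : Module.End ℂ V) (x : ℂ) (v : V) : V :=
  ∑ᶠ n : ℕ, (x ^ n / (n.factorial : ℂ)) • (A ^ n) v

section NilExp

variable {V : Type*} [AddCommGroup V] [Module ℂ V]

theorem pow_apply_eq_zero_of_le (A : Module.End ℂ V) {v : V} {N m : ℕ} (h : (A ^ N) v = 0)
    (hm : N ≤ m) : (A ^ m) v = 0 := by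
  obtain ⟨d, rfl⟩ := Nat.exists_eq_add_of_le' hm
  rw [pow_add, Module.End.mul_apply, h, map_zero]

theorem nilExpFun_eq_sum (A : Module.End ℂ V) (x : ℂ) {v : V} {N : ℕ} (h : (A ^ N) v = 0) :
    nilExpFun A x v = ∑ n ∈ Finset.range N, (x ^ n / (n.factorial : ℂ)) • (A ^ n) v := by
  refine finsum_eq_sum_of_support_subset _ fun n hn => ?_
  by_contra hcon
  simp only [Finset.coe_range, Set.mem_Iio, not_lt] at hcon
  exact hn (by simp [pow_apply_eq_zero_of_le A h hcon])

theorem nilExpFun_nilExpFun (A : Module.End ℂ V) (x y : ℂ) {v : V} {N : ℕ} (h : (A ^ N) v = 0) :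
    nilExpFun A x (nilExpFun A y v) = nilExpFun A (x + y) v := by
  have hN : (A ^ N) (nilExpFun A y v) = 0 := by
    rw [nilExpFun_eq_sum A y h, map_sum]
    refine Finset.sum_eq_zero fun n _ => ?_
    rw [map_smul, ← Module.End.mul_apply, ← pow_add,
      pow_apply_eq_zero_of_le A h (Nat.le_add_right N n), smul_zero]
  rw [nilExpFun_eq_sum A x hN, nilExpFun_eq_sum A y h, nilExpFun_eq_sum A _ h]
  have key : ∀ m ∈ Finset.range N, ((x + y) ^ m / (m.factorial : ℂ)) • (A ^ m) v =
      ∑ k ∈ Finset.range (m + 1), ((x ^ k / (k.factorial : ℂ)) *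
        (y ^ (m - k) / ((m - k).factorial : ℂ))) • (A ^ (k + (m - k))) v := by
    intro m _
    rw [add_pow, Finset.sum_div, Finset.sum_smul]
    refine Finset.sum_congr rfl fun k hk => ?_
    have hkm : k ≤ m := Nat.lt_succ_iff.mp (Finset.mem_range.mp hk)
    rw [Nat.add_sub_cancel' hkm, Nat.cast_choose ℂ hkm]
    congr 1
    have h1 := (Nat.cast_ne_zero (R := ℂ)).mpr m.factorial_ne_zero
    have h2 := (Nat.cast_ne_zero (R := ℂ)).mpr k.factorial_ne_zero
    have h3 := (Nat.cast_ne_zero (R := ℂ)).mpr (m - k).factorial_ne_zero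
    field_simp
  rw [Finset.sum_congr rfl key, Finset.sum_range_diag_flip N (fun i j =>
    ((x ^ i / (i.factorial : ℂ)) * (y ^ j / (j.factorial : ℂ))) • (A ^ (i + j)) v)]
  refine Finset.sum_congr rfl fun i _ => ?_
  rw [map_sum, Finset.smul_sum]
  symm
  refine Finset.sum_subset_zero_on_sdiff (Finset.range_mono (Nat.sub_le N i)) ?_ ?_
  · intro j hj
    simp only [Finset.mem_sdiff, Finset.mem_range, not_lt] at hj
    rw [map_smul, ← Module.End.mul_apply, ← pow_add,
      pow_apply_eq_zero_of_le A h (by omega), smul_zero, smul_zero]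
  · intro j _
    rw [map_smul, ← Module.End.mul_apply, ← pow_add, smul_smul]

theorem nilExpFun_zero (A : Module.End ℂ V) (v : V) : nilExpFun A 0 v = v := by
  unfold nilExpFun
  rw [finsum_eq_single _ 0 (fun n hn => by simp [hn])]
  simp

/-- `exp(x A)` for a locally nilpotent operator `A`; its inverse is `exp(-x A)`. -/
def nilExp (A : Module.End ℂ V) (hA : ∀ v, ∃ N : ℕ, (A ^ N) v = 0) (x : ℂ) : V ≃ₗ[ℂ] V where
  toFun := nilExpFun A x
  invFun := nilExpFun A (-x)
  map_add' v w := by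
    obtain ⟨N, hN⟩ := hA v
    obtain ⟨M, hM⟩ := hA w
    have hv := pow_apply_eq_zero_of_le A hN (le_max_left N M)
    have hw := pow_apply_eq_zero_of_le A hM (le_max_right N M)
    have hvw : (A ^ max N M) (v + w) = 0 := by rw [map_add, hv, hw, add_zero]
    rw [nilExpFun_eq_sum A x hv, nilExpFun_eq_sum A x hw, nilExpFun_eq_sum A x hvw,
      ← Finset.sum_add_distrib]
    exact Finset.sum_congr rfl fun n _ => by rw [map_add, smul_add]
  map_smul' c v := by
    obtain ⟨N, hN⟩ := hA v
    have hc : (A ^ N) (c • v) = 0 := by rw [map_smul, hN, smul_zero]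
    rw [nilExpFun_eq_sum A x hN, nilExpFun_eq_sum A x hc, RingHom.id_apply, Finset.smul_sum]
    exact Finset.sum_congr rfl fun n _ => by rw [map_smul, smul_comm]
  left_inv v := by
    obtain ⟨N, hN⟩ := hA v
    rw [nilExpFun_nilExpFun A _ _ hN, neg_add_cancel, nilExpFun_zero]
  right_inv v := by
    obtain ⟨N, hN⟩ := hA v
    rw [nilExpFun_nilExpFun A _ _ hN, add_neg_cancel, nilExpFun_zero]

end NilExp

namespace QVOA

variable {V : Type*} [AddCommGroup V] [Module ℂ V] (S : QVOA V)

/-! ### The operators `L(0)` and `L(1)` -/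

/-- The Euler operator `L(0)`, which acts on `V_k` as multiplication by `k`. -/
def L0 : Module.End ℂ V := S.rho slEuler

/-- The lowering operator `L(1)`. -/
def L1 : Module.End ℂ V := S.rho slLower

/-- The decomposition `V = ⨁ₖ V_k`. -/
def gradeEquiv : (DirectSum ℤ fun k => S.grade k) ≃ₗ[ℂ] V :=
  LinearEquiv.ofBijective (DirectSum.coeLinearMap S.grade) S.isInternal

theorem gradeEquiv_symm_of_mem {k : ℤ} {a : V} (ha : a ∈ S.grade k) :
    S.gradeEquiv.symm a = DirectSum.lof ℂ ℤ (fun k => S.grade k) k ⟨a, ha⟩ := by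
  rw [LinearEquiv.symm_apply_eq]
  exact (DirectSum.coeLinearMap_lof S.grade k ⟨a, ha⟩).symm

theorem grade_induction {p : V → Prop} (h0 : p 0) (hadd : ∀ v w, p v → p w → p (v + w))
    (hmem : ∀ k, ∀ a ∈ S.grade k, p a) (v : V) : p v := by
  have hv : v ∈ ⨆ k, S.grade k := by
    rw [S.isInternal.submodule_iSup_eq_top]
    trivial
  exact Submodule.iSup_induction S.grade (motive := p) hv hmem h0 hadd

/-- The linear map `z^{L(0)}` that multiplies `V_k` by `z^k`. -/
def powL0Map (z : ℂ) : Module.End ℂ V :=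
  DirectSum.toModule ℂ ℤ V (fun k => z ^ k • (S.grade k).subtype) ∘ₗ S.gradeEquiv.symm.toLinearMap

theorem powL0Map_of_mem (z : ℂ) {k : ℤ} {a : V} (ha : a ∈ S.grade k) :
    S.powL0Map z a = z ^ k • a := by
  rw [powL0Map, LinearMap.comp_apply, LinearEquiv.coe_coe, S.gradeEquiv_symm_of_mem ha,
    DirectSum.toModule_lof]
  rfl

theorem powL0Map_powL0Map (z w : ℂ) (h : z * w = 1) (v : V) :
    S.powL0Map z (S.powL0Map w v) = v := by
  refine S.grade_induction (p := fun v => S.powL0Map z (S.powL0Map w v) = v) (by simp)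
    (fun v w hv hw => by rw [map_add, map_add, hv, hw]) (fun k a ha => ?_) v
  rw [S.powL0Map_of_mem w ha, map_smul, S.powL0Map_of_mem z ha, smul_smul, ← mul_zpow,
    mul_comm w z, h, one_zpow, one_smul]

/-- The invertible operator `z^{L(0)}` for `z ≠ 0`. -/
def powL0 (z : ℂˣ) : V ≃ₗ[ℂ] V where
  __ := S.powL0Map z
  invFun := S.powL0Map (z⁻¹ : ℂˣ)
  left_inv v := S.powL0Map_powL0Map _ _ (by simp) v
  right_inv v := S.powL0Map_powL0Map _ _ (by simp) v

theorem lie_slEuler_slLower : ⁅slEuler, slLower⁆ = -slLower := by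
  apply Subtype.ext
  rw [LieAlgebra.SpecialLinear.sl_bracket]
  ext i j
  fin_cases i <;> fin_cases j <;> norm_num [slEuler, slLower]

theorem L0_of_mem {k : ℤ} {a : V} (ha : a ∈ S.grade k) : S.L0 a = (k : ℂ) • a :=
  S.rho_euler k a ha

theorem mem_grade_of_L0 {k : ℤ} {v : V} (hv : S.L0 v = (k : ℂ) • v) : v ∈ S.grade k := by
  classical
  have hcomp : ∀ (w : V) (n : ℤ), ((S.gradeEquiv.symm (S.L0 w)) n : V) =
      (n : ℂ) • ((S.gradeEquiv.symm w) n : V) := by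
    intro w n
    refine S.grade_induction (p := fun w => ((S.gradeEquiv.symm (S.L0 w)) n : V) =
      (n : ℂ) • ((S.gradeEquiv.symm w) n : V)) (by simp) ?_ ?_ w
    · intro v w hv hw
      rw [map_add, map_add, map_add, DirectSum.add_apply, DirectSum.add_apply,
        Submodule.coe_add, Submodule.coe_add, hv, hw, smul_add]
    · intro m a ha
      rw [S.L0_of_mem ha, map_smul, S.gradeEquiv_symm_of_mem ha, DirectSum.smul_apply,
        DirectSum.lof_eq_of, Submodule.coe_smul]
      by_cases hmn : m = n
      · subst hmn
        rfl
      · rw [DirectSum.of_eq_of_ne _ _ _ (Ne.symm hmn)]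
        simp
  have hzero : ∀ n, n ≠ k → (S.gradeEquiv.symm v) n = 0 := by
    intro n hn
    have h1 := hcomp v n
    rw [hv, map_smul, DirectSum.smul_apply, Submodule.coe_smul, ← sub_eq_zero, ← sub_smul] at h1
    rcases smul_eq_zero.mp h1 with h2 | h2
    · exact absurd (by exact_mod_cast (sub_eq_zero.mp h2).symm) hn
    · exact Subtype.ext h2
  have hsymm : S.gradeEquiv.symm v =
      DirectSum.lof ℂ ℤ (fun k => S.grade k) k ((S.gradeEquiv.symm v) k) := by
    refine DFinsupp.ext fun n => ?_
    by_cases hn : n = k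
    · subst hn
      rw [DirectSum.lof_eq_of, DirectSum.of_eq_same]
    · rw [DirectSum.lof_eq_of, DirectSum.of_eq_of_ne _ _ _ hn]
      exact hzero n hn
  rw [← S.gradeEquiv.apply_symm_apply v, hsymm]
  have := DirectSum.coeLinearMap_lof S.grade k ((S.gradeEquiv.symm v) k)
  exact this ▸ ((S.gradeEquiv.symm v) k).2

theorem L1_mem_grade {k : ℤ} {a : V} (ha : a ∈ S.grade k) : S.L1 a ∈ S.grade (k - 1) := by
  apply S.mem_grade_of_L0
  have h := congrArg (fun A : Module.End ℂ V => A a) (S.rho.map_lie slEuler slLower)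
  simp only [lie_slEuler_slLower, map_neg, LieRing.of_associative_ring_bracket,
    LinearMap.sub_apply, Module.End.mul_apply, LinearMap.neg_apply] at h
  rw [S.rho_euler k a ha, map_smul] at h
  change S.rho slEuler (S.rho slLower a) = _ • S.rho slLower a
  rw [eq_add_of_sub_eq h.symm]
  push_cast
  module

theorem L1_pow_apply_eq_zero (v : V) : ∃ N : ℕ, (S.L1 ^ N) v = 0 := by
  refine S.grade_induction (p := fun v => ∃ N : ℕ, (S.L1 ^ N) v = 0) ⟨0, by simp⟩ ?_ ?_ v
  · rintro v w ⟨N, hN⟩ ⟨M, hM⟩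
    exact ⟨max N M, by rw [map_add, pow_apply_eq_zero_of_le _ hN (le_max_left N M),
      pow_apply_eq_zero_of_le _ hM (le_max_right N M), add_zero]⟩
  · intro k a ha
    obtain ⟨n₀, hn₀⟩ := S.exists_grade_eq_bot
    have hmem : ∀ N : ℕ, (S.L1 ^ N) a ∈ S.grade (k - N) := by
      intro N
      induction N with
      | zero => simpa using ha
      | succ N ih =>
        rw [pow_succ', Module.End.mul_apply]
        have := S.L1_mem_grade ih
        rwa [show k - ((N + 1 : ℕ) : ℤ) = k - N - 1 by push_cast; ring]
    refine ⟨(k - n₀ + 1).toNat, ?_⟩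
    have := hmem (k - n₀ + 1).toNat
    rwa [hn₀ _ (by omega), Submodule.mem_bot] at this

/-- The invertible operator `exp(x L(1))`. -/
def expL1 (x : ℂ) : V ≃ₗ[ℂ] V := nilExp S.L1 S.L1_pow_apply_eq_zero x

end QVOA

/-! ### The slash action of `SL₂(ℤ)` -/

/-- `j(γ, τ) = cτ + d`. -/
def autFactor (γ : SL(2, ℤ)) (τ : ℍ) : ℂ := (γ 1 0 : ℂ) * (τ : ℂ) + (γ 1 1 : ℂ)

theorem autFactor_ne_zero (γ : SL(2, ℤ)) (τ : ℍ) : autFactor γ τ ≠ 0 := by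
  have h := UpperHalfPlane.denom_ne_zero (γ : GL (Fin 2) ℝ) τ
  rwa [ModularGroup.denom_apply] at h

/-- `j(γ, τ)` as an invertible complex number. -/
def autUnit (γ : SL(2, ℤ)) (τ : ℍ) : ℂˣ := Units.mk0 (autFactor γ τ) (autFactor_ne_zero γ τ)

/-- `X(γ, τ) = c / (cτ + d)`. -/
def cocycleX (γ : SL(2, ℤ)) (τ : ℍ) : ℂ := (γ 1 0 : ℂ) / autFactor γ τ

namespace QVOA

variable {V : Type*} [AddCommGroup V] [Module ℂ V] (S : QVOA V)

/-- The canonical cocycle `K(γ, τ) = exp(-c j(γ, τ) L(1)) j(γ, τ)^{-2 L(0)}`. -/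
def cocycleK (γ : SL(2, ℤ)) (τ : ℍ) : V ≃ₗ[ℂ] V :=
  (S.powL0 (autUnit γ τ ^ (-2 : ℤ))).trans (S.expL1 (-((γ 1 0 : ℂ) * autFactor γ τ)))

/-- The slash action `(f ‖_k γ)(τ) = j(γ, τ)^{-k} K(γ, τ)⁻¹ f(γτ)`. -/
def slash (k : ℤ) (f : ℍ → V) (γ : SL(2, ℤ)) (τ : ℍ) : V :=
  autFactor γ τ ^ (-k) • (S.cocycleK γ τ).symm (f (γ • τ))

/-! ### `V`-valued quasi-modular forms -/

/-- The truncation `F_N V = ⨁_{n ≤ N} V_n`, a finite-dimensional space. -/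
def truncation (N : ℤ) : Submodule ℂ V := ⨆ (n : ℤ) (_ : n ≤ N), S.grade n

/-- `f` is a holomorphic map from the upper half-plane to the finite-dimensional space `F_N V`:
all its coordinates are holomorphic. -/
def IsHolomorphic (N : ℤ) (f : ℍ → V) : Prop :=
  (∀ τ, f τ ∈ S.truncation N) ∧
    ∀ φ : Module.Dual ℂ V, MDifferentiable 𝓘(ℂ) 𝓘(ℂ) fun τ : ℍ => φ (f τ)

/-- `f` is given by a `q`-expansion `∑_{n ≥ 0} aₙ qⁿ` in `F_N V⟦q⟧`, `q = exp(2πiτ)`, which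
converges (in each coordinate) on the upper half-plane. -/
def IsHolomorphicAtCusp (N : ℤ) (f : ℍ → V) : Prop :=
  ∃ a : ℕ → V, (∀ n, a n ∈ S.truncation N) ∧
    ∀ (φ : Module.Dual ℂ V) (τ : ℍ),
      HasSum (fun n => φ (a n) * Complex.exp (2 * Real.pi * Complex.I * (τ : ℂ)) ^ n) (φ (f τ))

/-- The functions `Q₀, …, Q_s` are the coefficients in the quasi-modular transformation law
`(f ‖_k γ)(τ) = ∑_{n ≤ s} X(γ, τ)ⁿ Qₙ(τ)` of `f`, for all `γ ∈ SL₂(ℤ)`. -/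
def HasQuasiModularLaw (k : ℤ) (f : ℍ → V) (s : ℕ) (Q : ℕ → ℍ → V) : Prop :=
  ∀ (γ : SL(2, ℤ)) (τ : ℍ),
    S.slash k f γ τ = ∑ n ∈ Finset.range (s + 1), cocycleX γ τ ^ n • Q n τ

/-- The set `Q_k(V)` of holomorphic `V`-valued quasi-modular forms of weight `k` (and any depth):
`f` and the coefficients `Qₙ` are holomorphic on the upper half-plane and at the cusp. -/
def quasiModularForms (k : ℤ) : Set (ℍ → V) :=
  {f | ∃ (N : ℤ) (s : ℕ) (Q : ℕ → ℍ → V),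
    S.IsHolomorphic N f ∧ S.IsHolomorphicAtCusp N f ∧
    (∀ n ≤ s, S.IsHolomorphic N (Q n) ∧ S.IsHolomorphicAtCusp N (Q n)) ∧
    S.HasQuasiModularLaw k f s Q}

/-! ### The lowering operator `Λ` -/

end QVOA

/-- The map `ι : ℂ[E₂, E₄, E₆] ⊗ V → {functions ℍ → V}`, `p ⊗ v ↦ p(E₂(τ), E₄(τ), E₆(τ)) v`, with
`ℂ[E₂, E₄, E₆]` written as the polynomial ring in three variables. -/
def quasiModularEval (V : Type*) [AddCommGroup V] [Module ℂ V] :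
    MvPolynomial (Fin 3) ℂ ⊗[ℂ] V →ₗ[ℂ] (ℍ → V) :=
  LinearMap.pi fun τ => TensorProduct.lift
    ((LinearMap.lsmul ℂ V).comp (MvPolynomial.aeval
      ![EisensteinSeries.E2 τ, ModularForm.E₄ τ, ModularForm.E₆ τ]).toLinearMap)

namespace QVOA

variable {V : Type*} [AddCommGroup V] [Module ℂ V] (S : QVOA V)

/-- `(12 / 2πi) ∂/∂E₂ ⊗ id + id ⊗ L(1)` on `ℂ[E₂, E₄, E₆] ⊗ V`. -/
def tensorLowering : Module.End ℂ (MvPolynomial (Fin 3) ℂ ⊗[ℂ] V) :=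
  (12 / (2 * Real.pi * Complex.I) : ℂ) •
      TensorProduct.map (MvPolynomial.pderiv (0 : Fin 3)).toLinearMap LinearMap.id +
    TensorProduct.map LinearMap.id S.L1

/-- The operator `Λ = (12 / 2πi) ∂/∂E₂ + L(1)` on functions: it sends `ι(F)` to
`ι(((12 / 2πi) ∂/∂E₂ ⊗ id + id ⊗ L(1)) F)`, and functions outside the image of `ι` to `0`. -/
def lowering (f : ℍ → V) : ℍ → V :=
  Function.extend (quasiModularEval V)
    (fun F => quasiModularEval V (S.tensorLowering F)) (fun _ => 0) f

end QVOA

end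

/-!
Vector-valued quasi-modular forms as polynomials in the Eisenstein series.

Write `j = cτ + d`, `X = c / j` and `α = 12 / 2πi`. Since `L(1)` lowers degrees by one, conjugation
by `j^{2L(0)}` scales it by `j⁻²`, and the slash action becomes
`(f ‖_k γ)(τ) = exp(X L(1)) (j^{-k} j^{2L(0)} f(γτ))` (`QVOA.slash_eq_expL1`). Moving `exp(X L(1))` to
the other side of the transformation law shows that a coordinate of `f` in degree `n` is a scalar
quasi-modular form of weight `k - 2n` (`QVOA.exists_isScalarQuasiModular`).

A scalar quasi-modular form of weight `w` is an isobaric polynomial in `E₂, E₄, E₆`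
(`IsScalarQuasiModular.exists_aeval_eisensteinPoint`). Its leading coefficient `q_s` is a modular form
of weight `w - 2s`, by the cocycle rule for `X` and because `X` takes infinitely many values, and
subtracting `α^{-s} q_s E₂ˢ` lowers the depth, as `E₂(γτ) = j² (E₂(τ) + αX)`. In depth zero, one
subtracts a monomial in `E₄, E₆` and divides by `Δ = (E₄³ - E₆²) / 1728`.

The representation by a polynomial is unique because `E₂, E₄, E₆` are algebraically independent
(`eq_zero_of_aeval_eisensteinPoint`): a relation between them also holds at
`(j² E₂ + αcj, j⁴ E₄, j⁶ E₆)` for Zariski dense `(c, j)`, and `E₄³ / E₆²` takes infinitely many values.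

Finally, `exp(X Λ)` acts on `p ⊗ v` by `exp(X L(1))` on `v` and by the shift `E₂ ↦ E₂ + αX` on `p`
(`QVOA.quasiModularEval_expLowering_tmul`). For `p` isobaric of weight `k - 2n` and `v` of degree `n`
this is `‖_k γ`, which gives `f ‖_k γ = exp(X Λ) f`. The coefficients in the transformation law are
determined by `f`, again because `X` takes infinitely many values.
-/

/-! ### The Eisenstein series and the automorphy factor -/

/-- The point `(E₂(τ), E₄(τ), E₆(τ))`. -/
noncomputable def eisensteinPoint (τ : ℍ) : Fin 3 → ℂ :=
  ![EisensteinSeries.E2 τ, ModularForm.E₄ τ, ModularForm.E₆ τ]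

/-- The constant `12 / 2πi` in the transformation law of `E₂` and in the operator `Λ`. -/
noncomputable def e2Const : ℂ := 12 / (2 * Real.pi * Complex.I)

theorem e2Const_ne_zero : e2Const ≠ 0 := by
  have hpi : (Real.pi : ℂ) ≠ 0 := by exact_mod_cast Real.pi_ne_zero
  exact div_ne_zero (by norm_num) (mul_ne_zero (mul_ne_zero two_ne_zero hpi) Complex.I_ne_zero)

theorem autFactor_eq_denom (γ : SL(2, ℤ)) (τ : ℍ) : autFactor γ τ = denom γ τ :=
  (ModularGroup.denom_apply γ τ).symm

theorem autFactor_one (τ : ℍ) : autFactor 1 τ = 1 := by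
  simp [autFactor]

theorem autFactor_mul (γ δ : SL(2, ℤ)) (τ : ℍ) :
    autFactor (γ * δ) τ = autFactor γ (δ • τ) * autFactor δ τ := by
  simp [autFactor_eq_denom, denom_cocycle_σ, σ, ModularGroup.sl_moeb]

theorem cocycleX_mul (γ δ : SL(2, ℤ)) (τ : ℍ) :
    cocycleX (γ * δ) τ =
      autFactor δ τ ^ (-2 : ℤ) * cocycleX γ (δ • τ) + cocycleX δ τ := by
  have h1 := autFactor_ne_zero γ (δ • τ)
  have h2 := autFactor_ne_zero δ τ
  have hdet : ((δ 0 0 : ℤ) : ℂ) * (δ 1 1 : ℤ) - (δ 0 1 : ℤ) * (δ 1 0 : ℤ) = 1 := by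
    exact_mod_cast (Matrix.det_fin_two δ.1).symm.trans δ.2
  have hmul := autFactor_mul γ δ τ
  have hc : (((γ * δ) 1 0 : ℤ) : ℂ) = (γ 1 0 : ℤ) * (δ 0 0 : ℤ) + (γ 1 1 : ℤ) * (δ 1 0 : ℤ) := by
    simp [Matrix.mul_apply, Fin.sum_univ_two]
  have hd : (((γ * δ) 1 1 : ℤ) : ℂ) = (γ 1 0 : ℤ) * (δ 0 1 : ℤ) + (γ 1 1 : ℤ) * (δ 1 1 : ℤ) := by
    simp [Matrix.mul_apply, Fin.sum_univ_two]
  simp only [cocycleX]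
  rw [hmul, hc, zpow_neg, zpow_ofNat]
  have key : ((γ 1 0 : ℤ) * (δ 0 0 : ℤ) + (γ 1 1 : ℤ) * (δ 1 0 : ℤ) : ℂ) * autFactor δ τ =
      (γ 1 0 : ℤ) + (δ 1 0 : ℤ) * (autFactor γ (δ • τ) * autFactor δ τ) := by
    rw [← hmul, autFactor, autFactor, hc, hd]
    linear_combination (γ 1 0 : ℂ) * hdet
  field_simp
  linear_combination key

/-- Every coprime bottom row `(c, d)` occurs in `SL₂(ℤ)`. -/
theorem exists_bottom_row {c d : ℤ} (h : IsCoprime c d) :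
    ∃ γ : SL(2, ℤ), γ 1 0 = c ∧ γ 1 1 = d := by
  obtain ⟨γ, -, hγ⟩ := ModularGroup.bottom_row_surj (R := ℤ) (a := ![c, d]) h
  exact ⟨γ, congrFun hγ 0, congrFun hγ 1⟩

/-- For a fixed `τ`, the numbers `X(γ, τ)` are infinitely many. -/
theorem infinite_range_cocycleX (τ : ℍ) :
    (Set.range fun γ : SL(2, ℤ) => cocycleX γ τ).Infinite := by
  have hγ (d : ℤ) : ∃ γ : SL(2, ℤ), γ 1 0 = 1 ∧ γ 1 1 = d := exists_bottom_row isCoprime_one_left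
  choose γ hc hd using hγ
  refine Set.infinite_of_injective_forall_mem (f := fun d : ℤ => cocycleX (γ d) τ) ?_
    fun d => ⟨γ d, rfl⟩
  intro d e h
  simpa [cocycleX, autFactor, hc, hd] using h

open scoped ModularForm in
theorem smul_eq_autFactor_pow_mul {k : ℤ} {f : ℍ → ℂ} {g : ℂ} {γ : SL(2, ℤ)} {τ : ℍ}
    (h : (f ∣[k] γ) τ = g) : f (γ • τ) = autFactor γ τ ^ k * g := by
  rw [ModularForm.SL_slash_apply, ← autFactor_eq_denom] at h
  rw [← h, mul_left_comm, ← zpow_add₀ (autFactor_ne_zero γ τ)]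
  simp

theorem E2_smul (γ : SL(2, ℤ)) (τ : ℍ) :
    EisensteinSeries.E2 (γ • τ) =
      autFactor γ τ ^ (2 : ℤ) * (EisensteinSeries.E2 τ + e2Const * cocycleX γ τ) := by
  refine smul_eq_autFactor_pow_mul ?_
  rw [EisensteinSeries.E2_slash_action]
  have hpi : (Real.pi : ℂ) ≠ 0 := by exact_mod_cast Real.pi_ne_zero
  have := autFactor_ne_zero γ τ
  simp only [Pi.sub_apply, Pi.smul_apply, EisensteinSeries.D2, ← autFactor_eq_denom, smul_eq_mul,
    riemannZeta_two, cocycleX, e2Const]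
  field_simp
  linear_combination (-12) * (γ 1 0 : ℂ) * Complex.I_sq

theorem ModularForm.levelOne_smul {k : ℤ} (f : ModularForm 𝒮ℒ k) (γ : SL(2, ℤ)) (τ : ℍ) :
    f (γ • τ) = autFactor γ τ ^ k * f τ := by
  refine smul_eq_autFactor_pow_mul ?_
  have := SlashInvariantForm.slash_action_eqn f (γ : GL (Fin 2) ℝ) ⟨γ, rfl⟩
  exact congrFun this τ

/-- The values of a level one modular form tend to the constant term of its `q`-expansion. -/
theorem ModularForm.levelOne_tendsto_atImInfty {k : ℤ} (f : ModularForm 𝒮ℒ k) :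
    Filter.Tendsto f atImInfty (nhds ((qExpansion 1 f).coeff 0)) := by
  have h1 := ModularFormClass.analyticAt_cuspFunction_zero f one_pos one_mem_strictPeriods_SL
  have h2 := h1.continuousAt.tendsto.comp (qParam_tendsto_atImInfty one_pos)
  rw [qExpansion_coeff]
  simp only [Nat.factorial_zero, Nat.cast_one, inv_one, iteratedDeriv_zero, one_mul]
  refine h2.congr fun τ => ?_
  exact SlashInvariantFormClass.eq_cuspFunction f τ one_mem_strictPeriods_SL one_ne_zero

/-! ### Isobaric polynomials in the Eisenstein series -/

/-- The weights `2, 4, 6` of `E₂, E₄, E₆`, as integers, so that isobaric polynomials are defined for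
every integral weight; in negative weights only `0` is isobaric. -/
def eisensteinWeight : Fin 3 → ℤ := ![2, 4, 6]

theorem MvPolynomial.IsWeightedHomogeneous.aeval_zpow_mul {σ K : Type*} [Field K] {w : σ → ℤ}
    {n : ℤ} {p : MvPolynomial σ K} (hp : p.IsWeightedHomogeneous w n) {c : K} (hc : c ≠ 0)
    (x : σ → K) :
    aeval (fun i => c ^ w i * x i) p = c ^ n * aeval x p := by
  simp only [aeval_def, eval₂_eq, Finset.mul_sum]
  refine Finset.sum_congr rfl fun d hd => ?_
  have hn : Finsupp.weight w d = n := hp (mem_support_iff.mp hd)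
  simp only [mul_pow, Finset.prod_mul_distrib]
  have : ∏ i ∈ d.support, (c ^ w i) ^ d i = c ^ n := by
    have hpow : ∀ s : Finset σ, c ^ (∑ i ∈ s, d i • w i) = ∏ i ∈ s, (c ^ w i) ^ d i := by
      intro s
      classical
      induction s using Finset.induction_on with
      | empty => simp
      | insert i s hi ih =>
        rw [Finset.sum_insert hi, Finset.prod_insert hi, zpow_add₀ hc, ih, nsmul_eq_mul,
          mul_comm (d i : ℤ), zpow_mul, zpow_natCast]
    rw [← hn, Finsupp.weight_apply, Finsupp.sum, hpow]
  rw [this]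
  ring

theorem isWeightedHomogeneous_X_pow_mul_X_pow {k : ℤ} {a b : ℕ} (h : 4 * (a : ℤ) + 6 * b = k) :
    (MvPolynomial.X 1 ^ a * MvPolynomial.X 2 ^ b : MvPolynomial (Fin 3) ℂ).IsWeightedHomogeneous
      eisensteinWeight k := by
  have h1 := (MvPolynomial.isWeightedHomogeneous_X ℂ eisensteinWeight 1).pow a
  have h2 := (MvPolynomial.isWeightedHomogeneous_X ℂ eisensteinWeight 2).pow b
  convert h1.mul h2
  simp [eisensteinWeight]
  linarith

/-- Every level one modular form of weight `k` is an isobaric polynomial in `E₄` and `E₆`. The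
induction subtracts a monomial in `E₄` and `E₆` to reach a cusp form and divides that by
`Δ = (E₄³ - E₆²) / 1728`. -/
theorem ModularForm.exists_aeval_eisensteinPoint (m : ℕ) {k : ℤ} (hk : k < m)
    (f : ModularForm 𝒮ℒ k) :
    ∃ p : MvPolynomial (Fin 3) ℂ, p.IsWeightedHomogeneous eisensteinWeight k ∧
      ∀ τ, f τ = MvPolynomial.aeval (eisensteinPoint τ) p := by
  induction m generalizing k with
  | zero =>
    have := ModularFormClass.levelOne_neg_weight_eq_zero (by simpa using hk) f
    exact ⟨0, MvPolynomial.isWeightedHomogeneous_zero _ _ _, fun τ => by simp [this]⟩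
  | succ m ih =>
    have hzero (h : f = 0) : ∃ p : MvPolynomial (Fin 3) ℂ,
        p.IsWeightedHomogeneous eisensteinWeight k ∧
          ∀ τ, f τ = MvPolynomial.aeval (eisensteinPoint τ) p :=
      ⟨0, MvPolynomial.isWeightedHomogeneous_zero _ _ _, fun τ => by simp [h]⟩
    rcases Int.even_or_odd k with heven | hodd
    swap
    · exact hzero (levelOne_odd_weight_eq_zero hodd f)
    by_cases h2 : k = 2
    · subst h2
      exact hzero (rank_zero_iff_forall_zero.mp levelOne_weight_two_rank_zero f)
    rcases lt_or_ge k 0 with hneg | hnonneg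
    · exact ih (by omega) f
    obtain ⟨a, b, hab⟩ : ∃ a b : ℕ, 4 * (a : ℤ) + 6 * b = k := by
      obtain ⟨l, hl⟩ := heven
      rcases Int.even_or_odd l with ⟨r, hr⟩ | ⟨r, hr⟩
      · exact ⟨r.toNat, 0, by omega⟩
      · exact ⟨(r - 1).toNat, 1, by omega⟩
    let e : ModularForm 𝒮ℒ k :=
      ModularForm.mcast (by linarith) ((E₄.pow a).mul (E₆.pow b))
    have he (τ : ℍ) : e τ = E₄ τ ^ a * E₆ τ ^ b := by
      simp [e, ModularForm.mcast_apply, ModularForm.coe_mul, ModularForm.coe_pow]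
    have he0 : (qExpansion 1 e).coeff 0 = 1 := by
      have h4 : (qExpansion 1 (E₄ : ℍ → ℂ)).coeff 0 = 1 :=
        EisensteinSeries.E_qExpansion_coeff_zero _ ⟨2, rfl⟩
      have h6 : (qExpansion 1 (E₆ : ℍ → ℂ)).coeff 0 = 1 :=
        EisensteinSeries.E_qExpansion_coeff_zero _ ⟨3, rfl⟩
      have : qExpansion 1 e = qExpansion 1 E₄ ^ a * qExpansion 1 E₆ ^ b := by
        rw [← ModularForm.qExpansion_pow one_pos one_mem_strictPeriods_SL,
          ← ModularForm.qExpansion_pow one_pos one_mem_strictPeriods_SL,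
          ← ModularForm.qExpansion_mul one_pos one_mem_strictPeriods_SL]
        rfl
      rw [PowerSeries.coeff_zero_eq_constantCoeff] at h4 h6 ⊢
      rw [this, map_mul, map_pow, map_pow, h4, h6, one_pow, one_pow, one_mul]
    let c := (qExpansion 1 f).coeff 0
    let g : ModularForm 𝒮ℒ k := f - c • e
    have hg0 : (qExpansion 1 g).coeff 0 = 0 := by
      simp only [g, FunLike.coe_sub, FunLike.coe_smul]
      have h1 := ModularForm.qExpansion_sub one_pos one_mem_strictPeriods_SL f (c • e)
      rw [FunLike.coe_smul] at h1
      rw [h1, ModularForm.qExpansion_smul one_pos one_mem_strictPeriods_SL, map_sub,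
        PowerSeries.coeff_smul, he0, smul_eq_mul, mul_one, sub_self]
    obtain ⟨p, hp, hpf⟩ := ih (by omega) (CuspForm.discriminantEquiv (toCuspForm g hg0))
    refine ⟨MvPolynomial.C c * (.X 1 ^ a * .X 2 ^ b) +
      MvPolynomial.C (1 / 1728) * ((.X 1 ^ 3 * .X 2 ^ 0 - .X 1 ^ 0 * .X 2 ^ 2) * p), ?_, fun τ => ?_⟩
    · refine ((isWeightedHomogeneous_X_pow_mul_X_pow hab).C_mul c).add (.C_mul ?_ _)
      have h12 : (12 : ℤ) + (k - 12) = k := by ring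
      exact h12 ▸ ((isWeightedHomogeneous_X_pow_mul_X_pow (k := 12) (a := 3) (b := 0)
        (by norm_num)).sub (isWeightedHomogeneous_X_pow_mul_X_pow (by norm_num))).mul hp
    · have h1 := discriminant_mul_discriminantEquiv_apply (toCuspForm g hg0) τ
      rw [discriminant_eq_E₄_cube_sub_E₆_sq, hpf, toCuspForm_apply] at h1
      have h3 : g τ = f τ - c * (E₄ τ ^ a * E₆ τ ^ b) := by
        rw [← he]
        rfl
      simp only [map_add, map_mul, map_sub, map_pow, MvPolynomial.aeval_X, MvPolynomial.aeval_C,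
        eisensteinPoint, Matrix.cons_val] at h1 ⊢
      simp only [Algebra.algebraMap_self, RingHom.id_apply]
      rw [h3] at h1
      linear_combination -h1

/-- A polynomial expression in `E₂, E₄, E₆` of weight `k` transforms under `SL₂(ℤ)` like a modular
form of weight `k`, up to the shift `E₂ ↦ E₂ + (12 / 2πi) X`. -/
theorem aeval_eisensteinPoint_smul {k : ℤ} {p : MvPolynomial (Fin 3) ℂ}
    (hp : p.IsWeightedHomogeneous eisensteinWeight k) (γ : SL(2, ℤ)) (τ : ℍ) :
    MvPolynomial.aeval (eisensteinPoint (γ • τ)) p =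
      autFactor γ τ ^ k * MvPolynomial.aeval
        (eisensteinPoint τ + Pi.single 0 (e2Const * cocycleX γ τ)) p := by
  rw [← hp.aeval_zpow_mul (autFactor_ne_zero γ τ)]
  congr 2
  funext i
  fin_cases i
  · simpa [eisensteinPoint, eisensteinWeight] using E2_smul γ τ
  · simpa [eisensteinPoint, eisensteinWeight] using ModularForm.levelOne_smul ModularForm.E₄ γ τ
  · simpa [eisensteinPoint, eisensteinWeight] using ModularForm.levelOne_smul ModularForm.E₆ γ τ

/-! ### Scalar quasi-modular forms -/

/-- A polynomial in `X(γ, τ)` that vanishes for all `γ ∈ SL₂(ℤ)` is zero. -/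
theorem eq_zero_of_sum_cocycleX_pow_smul_eq_zero {V : Type*} [AddCommGroup V] [Module ℂ V]
    {τ : ℍ} {N : ℕ} {a : ℕ → V}
    (h : ∀ γ : SL(2, ℤ), ∑ n ∈ Finset.range N, cocycleX γ τ ^ n • a n = 0) {n : ℕ} (hn : n < N) :
    a n = 0 := by
  rw [← Module.forall_dual_apply_eq_zero_iff ℂ]
  intro φ
  have hP : (∑ n ∈ Finset.range N, Polynomial.monomial n (φ (a n))) = 0 := by
    refine Polynomial.eq_of_infinite_eval_eq _ _ ((infinite_range_cocycleX τ).mono ?_)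
    rintro _ ⟨γ, rfl⟩
    simpa [Polynomial.eval_finsetSum, mul_comm] using congrArg φ (h γ)
  have := congrArg (fun P => Polynomial.coeff P n) hP
  simpa [Polynomial.finsetSum_coeff, Polynomial.coeff_monomial, hn] using this

/-- The transformation law `(g |_w γ)(τ) = ∑_{n ≤ s} X(γ, τ)ⁿ qₙ(τ)` of scalar quasi-modular forms
of weight `w`, written for the value `g(γτ)`. Holomorphy of the `qₙ`, on the upper half-plane and at
the cusp, is not part of the definition. -/
def IsScalarQuasiModular (w : ℤ) (s : ℕ) (g : ℍ → ℂ) (q : ℕ → ℍ → ℂ) : Prop :=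
  ∀ (γ : SL(2, ℤ)) (τ : ℍ),
    g (γ • τ) = autFactor γ τ ^ w * ∑ n ∈ Finset.range (s + 1), cocycleX γ τ ^ n * q n τ

/-- The leading coefficient of a quasi-modular form of weight `w` and depth `s` is modular of weight
`w - 2s`: the cocycle rule `X(γδ, τ) = j(δ, τ)⁻² X(γ, δτ) + X(δ, τ)` compares the coefficients of
`X(γ, δτ)ˢ` in the two expressions for the value at `γδτ`. -/
theorem IsScalarQuasiModular.leading_smul {w : ℤ} {s : ℕ} {g : ℍ → ℂ} {q : ℕ → ℍ → ℂ}
    (h : IsScalarQuasiModular w s g q) (δ : SL(2, ℤ)) (τ : ℍ) :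
    q s (δ • τ) = autFactor δ τ ^ (w - 2 * s) * q s τ := by
  have hj := autFactor_ne_zero δ τ
  -- `X(γδ, τ)` as a polynomial in `X(γ, δτ)`
  set L : Polynomial ℂ := .C (autFactor δ τ ^ (-2 : ℤ)) * .X + .C (cocycleX δ τ) with hL
  have hLdeg : L.natDegree ≤ 1 := Polynomial.natDegree_linear_le
  have hPQ : (∑ n ∈ Finset.range (s + 1), Polynomial.monomial n (q n (δ • τ))) =
      .C (autFactor δ τ ^ w) * ∑ n ∈ Finset.range (s + 1), L ^ n * .C (q n τ) := by
    refine Polynomial.eq_of_infinite_eval_eq _ _ ((infinite_range_cocycleX (δ • τ)).mono ?_)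
    rintro _ ⟨γ, rfl⟩
    have h1 := h γ (δ • τ)
    have h2 := h (γ * δ) τ
    rw [← mul_smul, h2, autFactor_mul, mul_zpow, mul_assoc] at h1
    have h3 := mul_left_cancel₀ (zpow_ne_zero w (autFactor_ne_zero γ (δ • τ))) h1
    simp only [Set.mem_ofPred_eq, Polynomial.eval_finsetSum, Polynomial.eval_monomial,
      Polynomial.eval_mul, Polynomial.eval_C, Polynomial.eval_pow, hL, Polynomial.eval_add,
      Polynomial.eval_X, ← cocycleX_mul]
    rw [h3]
    exact Finset.sum_congr rfl fun n _ => mul_comm _ _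
  have hcoeff := congrArg (fun P => Polynomial.coeff P s) hPQ
  simp only [Polynomial.finsetSum_coeff, Polynomial.coeff_monomial, Polynomial.coeff_C_mul,
    Polynomial.coeff_mul_C] at hcoeff
  rw [Finset.sum_ite_eq' , if_pos (Finset.self_mem_range_succ s), Finset.sum_eq_single s] at hcoeff
  · have htop : (L ^ s).coeff s = (autFactor δ τ ^ (-2 : ℤ)) ^ s := by
      have := Polynomial.coeff_pow_of_natDegree_le (m := s) hLdeg
      rw [mul_one] at this
      rw [this, hL]
      simp
    rw [hcoeff, htop, sub_eq_add_neg, zpow_add₀ hj, ← zpow_natCast, ← zpow_mul, mul_assoc]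
    congr 3
  · intro n hn hns
    have hlt : n < s := lt_of_le_of_ne (Nat.lt_succ_iff.mp (Finset.mem_range.mp hn)) hns
    rw [Polynomial.coeff_eq_zero_of_natDegree_lt, zero_mul]
    calc (L ^ n).natDegree ≤ n * L.natDegree := Polynomial.natDegree_pow_le
      _ ≤ n * 1 := Nat.mul_le_mul_left n hLdeg
      _ < s := by omega
  · simp

/-- The case of depth zero: the hypotheses make `f` a modular form of weight `k`. -/
theorem exists_aeval_eisensteinPoint_of_smul {k : ℤ} {f : ℍ → ℂ}
    (hf : ∀ (γ : SL(2, ℤ)) (τ : ℍ), f (γ • τ) = autFactor γ τ ^ k * f τ)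
    (hol : MDifferentiable 𝓘(ℂ) 𝓘(ℂ) f) (hbdd : IsBoundedAtImInfty f) :
    ∃ p : MvPolynomial (Fin 3) ℂ, p.IsWeightedHomogeneous eisensteinWeight k ∧
      ∀ τ, f τ = MvPolynomial.aeval (eisensteinPoint τ) p := by
  have hslash (γ : SL(2, ℤ)) : SlashAction.map k γ f = f := by
    funext τ
    rw [ModularForm.SL_slash_apply, hf, ← autFactor_eq_denom, mul_right_comm,
      ← zpow_add₀ (autFactor_ne_zero γ τ)]
    simp
  let F : ModularForm 𝒮ℒ k :=
    { toFun := f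
      slash_action_eq' := fun _ ⟨γ, hγ⟩ => hγ ▸ hslash γ
      holo' := hol
      bdd_at_cusps' := fun {c} hc => by
        rw [OnePoint.isBoundedAt_iff_forall_SL2Z hc]
        intro γ _
        rw [hslash γ]
        exact hbdd }
  exact ModularForm.exists_aeval_eisensteinPoint (k + 1).toNat (by omega) F

/-- Quasi-modular forms are isobaric polynomials in `E₂, E₄, E₆`, by induction on the depth: a
multiple of `q_s E₂ˢ`, with `q_s` the leading coefficient, lowers the depth `s`. -/
theorem IsScalarQuasiModular.exists_aeval_eisensteinPoint {w : ℤ} {s : ℕ} {g : ℍ → ℂ}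
    {q : ℕ → ℍ → ℂ} (h : IsScalarQuasiModular w s g q)
    (hol : ∀ n ≤ s, MDifferentiable 𝓘(ℂ) 𝓘(ℂ) (q n)) (hbdd : ∀ n ≤ s, IsBoundedAtImInfty (q n)) :
    ∃ p : MvPolynomial (Fin 3) ℂ, p.IsWeightedHomogeneous eisensteinWeight w ∧
      ∀ τ, g τ = MvPolynomial.aeval (eisensteinPoint τ) p := by
  induction s generalizing g q with
  | zero =>
    have hg : g = q 0 := funext fun τ => by simpa [autFactor_one] using h 1 τ
    rw [hg]
    exact exists_aeval_eisensteinPoint_of_smul (fun γ τ => by simpa using h.leading_smul γ τ)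
      (hol 0 le_rfl) (hbdd 0 le_rfl)
  | succ s ih =>
    obtain ⟨p, hp, hpq⟩ := exists_aeval_eisensteinPoint_of_smul h.leading_smul
      (hol _ le_rfl) (hbdd _ le_rfl)
    have hα := e2Const_ne_zero
    -- `c q_{s+1} E₂ˢ⁺¹` has leading coefficient `q_{s+1}`; its other coefficients are
    -- `r n q_{s+1} E₂ˢ⁺¹⁻ⁿ`, by the binomial expansion of `(E₂ + (12 / 2πi) X)ˢ⁺¹`.
    let c : ℂ := (e2Const ^ (s + 1))⁻¹
    let r (n : ℕ) : ℂ := c * e2Const ^ n * (s + 1).choose n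
    have hlaw : IsScalarQuasiModular w s
        (fun τ => g τ - c * q (s + 1) τ * EisensteinSeries.E2 τ ^ (s + 1))
        (fun n => q n - r n • (q (s + 1) * EisensteinSeries.E2 ^ (s + 1 - n))) := by
      intro γ τ
      have hj := autFactor_ne_zero γ τ
      have hjw : autFactor γ τ ^ (w - 2 * (s + 1 : ℕ)) * (autFactor γ τ ^ (2 : ℤ)) ^ (s + 1) =
          autFactor γ τ ^ w := by
        rw [← zpow_natCast (autFactor γ τ ^ (2 : ℤ)), ← zpow_mul, ← zpow_add₀ hj]
        congr 1
        ring
      have hbinom : c * (EisensteinSeries.E2 τ + e2Const * cocycleX γ τ) ^ (s + 1) =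
          ∑ n ∈ Finset.range (s + 1),
            cocycleX γ τ ^ n * (r n * EisensteinSeries.E2 τ ^ (s + 1 - n)) +
            cocycleX γ τ ^ (s + 1) := by
        rw [add_comm, add_pow, Finset.sum_range_succ, mul_add, Finset.mul_sum]
        congr 1
        · refine Finset.sum_congr rfl fun n _ => ?_
          simp only [r, mul_pow]
          ring
        · simp only [c, mul_pow, Nat.choose_self, Nat.cast_one, Nat.sub_self, pow_zero, mul_one]
          field_simp
      have hsum : ∑ n ∈ Finset.range (s + 1), cocycleX γ τ ^ n *
          (q n - r n • (q (s + 1) * EisensteinSeries.E2 ^ (s + 1 - n))) τ =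
          ∑ n ∈ Finset.range (s + 1), cocycleX γ τ ^ n * q n τ - q (s + 1) τ *
          ∑ n ∈ Finset.range (s + 1),
            cocycleX γ τ ^ n * (r n * EisensteinSeries.E2 τ ^ (s + 1 - n)) := by
        rw [Finset.mul_sum, ← Finset.sum_sub_distrib]
        refine Finset.sum_congr rfl fun n _ => ?_
        simp only [Pi.sub_apply, Pi.smul_apply, Pi.mul_apply, Pi.pow_apply, smul_eq_mul]
        ring
      rw [hsum, ← sub_eq_of_eq_add hbinom]
      simp only
      rw [h γ τ, h.leading_smul, E2_smul, Finset.sum_range_succ, mul_pow, ← hjw]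
      ring
    have hol' (n : ℕ) (hn : n ≤ s) : MDifferentiable 𝓘(ℂ) 𝓘(ℂ)
        (q n - r n • (q (s + 1) * EisensteinSeries.E2 ^ (s + 1 - n))) :=
      (hol n (by omega)).sub (((hol _ le_rfl).mul (E2_mdifferentiable.pow _)).const_smul _)
    have hbdd' (n : ℕ) (hn : n ≤ s) : IsBoundedAtImInfty
        (q n - r n • (q (s + 1) * EisensteinSeries.E2 ^ (s + 1 - n))) := by
      let B := boundedAtImInftySubalgebra ℂ
      have h1 : q n ∈ B := hbdd n (by omega)
      have h2 : q (s + 1) ∈ B := hbdd _ le_rfl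
      have h3 : EisensteinSeries.E2 ∈ B := EisensteinSeries.isBoundedAtImInfty_E2
      exact B.sub_mem h1 (B.smul_mem (B.mul_mem h2 (B.pow_mem h3 _)) _)
    obtain ⟨p', hp', hpg⟩ := ih hlaw hol' hbdd'
    refine ⟨p' + .C c * (p * .X 0 ^ (s + 1)), ?_, fun τ => ?_⟩
    · refine hp'.add (.C_mul ?_ c)
      have h1 := hp.mul ((MvPolynomial.isWeightedHomogeneous_X ℂ eisensteinWeight 0).pow (s + 1))
      convert h1 using 1
      simp [eisensteinWeight]
      ring
    · have := hpg τ
      simp only [map_add, map_mul, map_pow, MvPolynomial.aeval_X, MvPolynomial.aeval_C, ← hpq]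
      rw [← this]
      simp [eisensteinPoint]
      ring

/-! ### Algebraic independence of the Eisenstein series -/

/-- The function `E₄³ / E₆²` takes infinitely many values, as `E₄³ / E₆² - 1 = 1728 Δ / E₆²` tends to
`0` at `i∞` without vanishing. -/
theorem infinite_setOf_E₄_cube_div_E₆_sq :
    {J : ℂ | ∃ τ : ℍ, ModularForm.E₄ τ ≠ 0 ∧ ModularForm.E₆ τ ≠ 0 ∧
      J = ModularForm.E₄ τ ^ 3 / ModularForm.E₆ τ ^ 2}.Infinite := by
  intro hfin
  set A := {J : ℂ | ∃ τ : ℍ, ModularForm.E₄ τ ≠ 0 ∧ ModularForm.E₆ τ ≠ 0 ∧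
      J = ModularForm.E₄ τ ^ 3 / ModularForm.E₆ τ ^ 2}
  have h4 := ModularForm.levelOne_tendsto_atImInfty ModularForm.E₄
  have h6 := ModularForm.levelOne_tendsto_atImInfty ModularForm.E₆
  rw [EisensteinSeries.E_qExpansion_coeff_zero _ ⟨2, rfl⟩] at h4
  rw [EisensteinSeries.E_qExpansion_coeff_zero _ ⟨3, rfl⟩] at h6
  have hJ := (h4.pow 3).div (h6.pow 2) (by norm_num)
  have hone : (1 : ℂ) ∉ A := by
    rintro ⟨τ, -, hτ, h⟩
    have hΔ := ModularForm.discriminant_eq_E₄_cube_sub_E₆_sq τ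
    rw [eq_div_iff (pow_ne_zero 2 hτ), one_mul] at h
    rw [← h, sub_self, zero_div] at hΔ
    exact ModularForm.discriminant_ne_zero τ hΔ
  have hopen : Aᶜ ∈ nhds ((1 : ℂ) ^ 3 / 1 ^ 2) := by
    rw [one_pow, one_pow, div_one]
    exact hfin.isClosed.isOpen_compl.mem_nhds hone
  obtain ⟨τ, h1, h2, h3⟩ := ((hJ.eventually hopen).and
    ((h4.eventually_ne one_ne_zero).and (h6.eventually_ne one_ne_zero))).exists
  exact h1 ⟨τ, h2, h3, rfl⟩

/-- If `p(E₂, E₄, E₆) = 0`, then `p` also vanishes on the `SL₂(ℤ)`-translates of this identity: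
`p(j² E₂ + (12 / 2πi) c j, j⁴ E₄, j⁶ E₆) = 0`. The pairs `(c, j)` are Zariski dense, so the first
argument becomes free, and so does `j`. -/
theorem eval_eq_zero_of_aeval_eisensteinPoint {p : MvPolynomial (Fin 3) ℂ}
    (hp : ∀ τ, MvPolynomial.aeval (eisensteinPoint τ) p = 0) (τ : ℍ) (u : ℂ) {j : ℂ} (hj : j ≠ 0) :
    MvPolynomial.eval ![u, j ^ 4 * ModularForm.E₄ τ, j ^ 6 * ModularForm.E₆ τ] p = 0 := by
  -- The value of `p` at `pt c j` is a polynomial `P c` in `j`, and a polynomial `Q j` in `c`.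
  let pt (c j : ℂ) : Fin 3 → ℂ := ![j ^ 2 * EisensteinSeries.E2 τ + e2Const * c * j,
    j ^ 4 * ModularForm.E₄ τ, j ^ 6 * ModularForm.E₆ τ]
  let P (c : ℂ) : Polynomial ℂ := MvPolynomial.aeval
    ![.X ^ 2 * .C (EisensteinSeries.E2 τ) + .C (e2Const * c) * .X,
      .X ^ 4 * .C (ModularForm.E₄ τ), .X ^ 6 * .C (ModularForm.E₆ τ)] p
  let Q (j : ℂ) : Polynomial ℂ := MvPolynomial.aeval
    ![.C (j ^ 2 * EisensteinSeries.E2 τ) + .C (e2Const * j) * .X,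
      .C (j ^ 4 * ModularForm.E₄ τ), .C (j ^ 6 * ModularForm.E₆ τ)] p
  have hP (c j : ℂ) : (P c).eval j = MvPolynomial.eval (pt c j) p := by
    rw [← Polynomial.coe_aeval_eq_eval, ← MvPolynomial.coe_aeval_eq_eval]
    simp only [P, RingHom.coe_coe, MvPolynomial.comp_aeval_apply]
    congr 2
    funext i
    fin_cases i <;> simp [pt] <;> ring
  have hQ (c j : ℂ) : (Q j).eval c = MvPolynomial.eval (pt c j) p := by
    rw [← Polynomial.coe_aeval_eq_eval, ← MvPolynomial.coe_aeval_eq_eval]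
    simp only [Q, RingHom.coe_coe, MvPolynomial.comp_aeval_apply]
    congr 2
    funext i
    fin_cases i <;> simp [pt]
    ring
  -- For `c ≠ 0`, the rows `(c, 1 + c m)` of elements of `SL₂(ℤ)` give infinitely many roots `j`.
  have hPc (c : ℤ) (hc : c ≠ 0) : P c = 0 := by
    refine Polynomial.eq_zero_of_infinite_isRoot _ ?_
    refine Set.infinite_of_injective_forall_mem
      (f := fun m : ℤ => (c : ℂ) * (τ : ℂ) + ((1 + c * m : ℤ) : ℂ)) ?_ fun m => ?_
    · intro m n h
      have hc' : (c : ℂ) ≠ 0 := by exact_mod_cast hc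
      simpa [hc'] using h
    · obtain ⟨γ, hγc, hγd⟩ := exists_bottom_row (c := c) (d := 1 + c * m) ⟨-m, 1, by ring⟩
      have hj := autFactor_ne_zero γ τ
      have hγ := hp (γ • τ)
      rw [Set.mem_ofPred_eq, Polynomial.IsRoot, hP, ← hγ, ← MvPolynomial.coe_aeval_eq_eval,
        show (c : ℂ) * (τ : ℂ) + ((1 + c * m : ℤ) : ℂ) = autFactor γ τ by
          rw [autFactor, hγc, hγd], ← hγc]
      change MvPolynomial.aeval (pt (γ 1 0 : ℂ) (autFactor γ τ)) p = _
      congr 2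
      funext i
      fin_cases i
      · simp only [pt, eisensteinPoint, E2_smul, cocycleX]
        simp
        field_simp
      · simpa [pt, eisensteinPoint] using (ModularForm.levelOne_smul ModularForm.E₄ γ τ).symm
      · simpa [pt, eisensteinPoint] using (ModularForm.levelOne_smul ModularForm.E₆ γ τ).symm
  have hQj (j : ℂ) : Q j = 0 := by
    refine Polynomial.eq_zero_of_infinite_isRoot _ ?_
    refine Set.infinite_of_injective_forall_mem (f := fun m : ℕ => ((m + 1 : ℤ) : ℂ)) ?_ fun m => ?_
    · intro m n h
      simpa using h
    · rw [Set.mem_ofPred_eq, Polynomial.IsRoot, hQ, ← hP, hPc _ (by omega), Polynomial.eval_zero]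
  have h := hQ ((u - j ^ 2 * EisensteinSeries.E2 τ) / (e2Const * j)) j
  rw [hQj, Polynomial.eval_zero] at h
  rw [h]
  have hα := e2Const_ne_zero
  simp only [pt]
  congr 3
  field_simp
  ring

/-- The Eisenstein series `E₂, E₄, E₆` are algebraically independent. -/
theorem eq_zero_of_aeval_eisensteinPoint {p : MvPolynomial (Fin 3) ℂ}
    (hp : ∀ τ, MvPolynomial.aeval (eisensteinPoint τ) p = 0) : p = 0 := by
  -- In the coordinates `(u, v² J, v³ J)` the zeros of `p` contain a product of infinite sets.
  let P : MvPolynomial (Fin 3) ℂ :=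
    MvPolynomial.aeval ![.X 0, .X 1 ^ 2 * .X 2, .X 1 ^ 3 * .X 2] p
  have heval (x : Fin 3 → ℂ) :
      MvPolynomial.eval x P = MvPolynomial.eval ![x 0, x 1 ^ 2 * x 2, x 1 ^ 3 * x 2] p := by
    rw [← MvPolynomial.coe_aeval_eq_eval, ← MvPolynomial.coe_aeval_eq_eval]
    simp only [P, RingHom.coe_coe, MvPolynomial.comp_aeval_apply]
    congr 2
    funext i
    fin_cases i <;> simp
  have hne : {z : ℂ | z ≠ 0}.Infinite := (Set.finite_singleton (0 : ℂ)).infinite_compl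
  have hP : P = 0 := by
    refine MvPolynomial.funext_set ![Set.univ, {z : ℂ | z ≠ 0},
      {J : ℂ | ∃ τ : ℍ, ModularForm.E₄ τ ≠ 0 ∧ ModularForm.E₆ τ ≠ 0 ∧
        J = ModularForm.E₄ τ ^ 3 / ModularForm.E₆ τ ^ 2}] ?_ fun x hx => ?_
    · intro i
      fin_cases i
      · exact Set.infinite_univ
      · exact hne
      · exact infinite_setOf_E₄_cube_div_E₆_sq
    · have h1 : x 1 ≠ 0 := hx 1 trivial
      obtain ⟨τ, h4, h6, hJ⟩ := hx 2 trivial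
      -- With `j² = x₁ E₄ / E₆`, the point `(j⁴ E₄, j⁶ E₆)` is `(x₁² J, x₁³ J)`.
      obtain ⟨j, hj⟩ := IsAlgClosed.exists_pow_nat_eq
        (x 1 * ModularForm.E₄ τ / ModularForm.E₆ τ) (n := 2) (by norm_num)
      have hj0 : j ≠ 0 := by
        rintro rfl
        exact div_ne_zero (mul_ne_zero h1 h4) h6 (by simpa using hj.symm)
      have := eval_eq_zero_of_aeval_eisensteinPoint hp τ (x 0) hj0
      rw [show j ^ 4 = (j ^ 2) ^ 2 by ring, show j ^ 6 = (j ^ 2) ^ 3 by ring, hj] at this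
      rw [heval, map_zero, ← this, hJ]
      congr 2
      field_simp
  refine MvPolynomial.funext_set ![Set.univ, {z : ℂ | z ≠ 0}, {z : ℂ | z ≠ 0}] ?_ fun x hx => ?_
  · intro i
    fin_cases i
    exacts [Set.infinite_univ, hne, hne]
  · have h1 : x 1 ≠ 0 := hx 1 trivial
    have h2 : x 2 ≠ 0 := hx 2 trivial
    have h := heval ![x 0, x 2 / x 1, x 1 ^ 3 / x 2 ^ 2]
    rw [hP, map_zero] at h
    rw [map_zero, h]
    congr 2
    funext i
    fin_cases i
    · simp
    · simp
      field_simp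
    · simp
      field_simp

/-! ### The operator `Λ` on `ℂ[E₂, E₄, E₆] ⊗ V` -/

section Tensor

variable {V : Type*} [AddCommGroup V] [Module ℂ V]

theorem quasiModularEval_tmul (p : MvPolynomial (Fin 3) ℂ) (v : V) (τ : ℍ) :
    quasiModularEval V (p ⊗ₜ v) τ = MvPolynomial.aeval (eisensteinPoint τ) p • v := rfl

theorem quasiModularEval_smul (p : MvPolynomial (Fin 3) ℂ) (F : MvPolynomial (Fin 3) ℂ ⊗[ℂ] V)
    (τ : ℍ) :
    quasiModularEval V (p • F) τ =
      MvPolynomial.aeval (eisensteinPoint τ) p • quasiModularEval V F τ := by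
  induction F using TensorProduct.induction_on with
  | zero => simp
  | tmul q v =>
    rw [TensorProduct.smul_tmul', quasiModularEval_tmul, quasiModularEval_tmul, smul_eq_mul,
      map_mul, mul_smul]
  | add F G hF hG => rw [smul_add, map_add, map_add, Pi.add_apply, Pi.add_apply, hF, hG, smul_add]

theorem quasiModularEval_injective : Function.Injective (quasiModularEval V) := by
  classical
  rw [injective_iff_map_eq_zero]
  intro F hF
  let b := Module.Basis.ofVectorSpace ℂ V
  let e := TensorProduct.equivFinsuppOfBasisRight (M := MvPolynomial (Fin 3) ℂ) b
  have key (τ : ℍ) (i) (G : MvPolynomial (Fin 3) ℂ ⊗[ℂ] V) :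
      MvPolynomial.aeval (eisensteinPoint τ) (e G i) = b.repr (quasiModularEval V G τ) i := by
    induction G using TensorProduct.induction_on with
    | zero => simp
    | tmul q v =>
      rw [TensorProduct.equivFinsuppOfBasisRight_apply_tmul_apply, quasiModularEval_tmul]
      simp [mul_comm]
    | add F G hF hG => simp only [map_add, Finsupp.add_apply, hF, hG, Pi.add_apply]
  refine e.map_eq_zero_iff.mp (Finsupp.ext fun i => ?_)
  refine eq_zero_of_aeval_eisensteinPoint fun τ => ?_
  rw [key, hF]
  simp

/-- The tensors `1 ⊗ v` generate `ℂ[E₂, E₄, E₆] ⊗ V` under addition and multiplication by the three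
variables. -/
theorem eisensteinTensor_induction {P : MvPolynomial (Fin 3) ℂ ⊗[ℂ] V → Prop}
    (one_tmul : ∀ v : V, P ((1 : MvPolynomial (Fin 3) ℂ) ⊗ₜ[ℂ] v))
    (add : ∀ F G, P F → P G → P (F + G))
    (X_smul : ∀ (i : Fin 3) F, P F → P ((.X i : MvPolynomial (Fin 3) ℂ) • F))
    (F : MvPolynomial (Fin 3) ℂ ⊗[ℂ] V) : P F := by
  have htmul (p : MvPolynomial (Fin 3) ℂ) (v : V) : P (p ⊗ₜ[ℂ] v) := by
    induction p using MvPolynomial.induction_on with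
    | C a =>
      have : (MvPolynomial.C a : MvPolynomial (Fin 3) ℂ) = a • 1 := by
        rw [MvPolynomial.smul_eq_C_mul, mul_one]
      rw [this, TensorProduct.smul_tmul]
      exact one_tmul _
    | add p q hp hq =>
      rw [TensorProduct.add_tmul]
      exact add _ _ hp hq
    | mul_X p i hp =>
      have := X_smul i _ hp
      rwa [TensorProduct.smul_tmul', smul_eq_mul, mul_comm] at this
  induction F using TensorProduct.induction_on with
  | zero => simpa using one_tmul 0
  | tmul p v => exact htmul p v
  | add F G hF hG => exact add F G hF hG

namespace QVOA

variable (S : QVOA V)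

theorem tensorLowering_tmul (p : MvPolynomial (Fin 3) ℂ) (v : V) :
    S.tensorLowering (p ⊗ₜ v) =
      e2Const • (MvPolynomial.pderiv 0 p ⊗ₜ[ℂ] v) + p ⊗ₜ[ℂ] S.L1 v := rfl

theorem tensorLowering_smul (p : MvPolynomial (Fin 3) ℂ) (F : MvPolynomial (Fin 3) ℂ ⊗[ℂ] V) :
    S.tensorLowering (p • F) =
      p • S.tensorLowering F + e2Const • (MvPolynomial.pderiv 0 p • F) := by
  induction F using TensorProduct.induction_on with
  | zero => simp
  | tmul q v =>
    rw [TensorProduct.smul_tmul', smul_eq_mul, tensorLowering_tmul, tensorLowering_tmul,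
      Derivation.leibniz, TensorProduct.add_tmul, smul_add, smul_add, smul_comm p e2Const]
    simp only [TensorProduct.smul_tmul', smul_eq_mul, mul_comm q]
    rw [add_right_comm]
  | add F G hF hG => simp only [smul_add, map_add, hF, hG]; abel

theorem tensorLowering_pow_one_tmul (n : ℕ) (v : V) :
    (S.tensorLowering ^ n) (1 ⊗ₜ v) = 1 ⊗ₜ[ℂ] (S.L1 ^ n) v := by
  induction n with
  | zero => simp
  | succ n ih =>
    rw [pow_succ', Module.End.mul_apply, ih, tensorLowering_tmul, pow_succ', Module.End.mul_apply]
    simp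

theorem tensorLowering_pow_X_smul (i : Fin 3) (n : ℕ) (F : MvPolynomial (Fin 3) ℂ ⊗[ℂ] V) :
    (S.tensorLowering ^ (n + 1)) ((.X i : MvPolynomial (Fin 3) ℂ) • F) =
      (.X i : MvPolynomial (Fin 3) ℂ) • (S.tensorLowering ^ (n + 1)) F +
        ((n + 1) * (Pi.single 0 e2Const : Fin 3 → ℂ) i) • (S.tensorLowering ^ n) F := by
  induction n with
  | zero =>
    rw [zero_add, pow_one, pow_zero, tensorLowering_smul, MvPolynomial.pderiv_X]
    by_cases hi : i = 0
    · subst hi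
      simp
    · simp [hi]
  | succ n ih =>
    rw [pow_succ', Module.End.mul_apply, ih, map_add, tensorLowering_smul, map_smul,
      ← Module.End.mul_apply, ← pow_succ', ← Module.End.mul_apply, ← pow_succ',
      MvPolynomial.pderiv_X]
    by_cases hi : i = 0
    · subst hi
      simp only [Pi.single_eq_same, one_smul]
      push_cast
      module
    · simp [hi]

theorem tensorLowering_pow_apply_eq_zero (F : MvPolynomial (Fin 3) ℂ ⊗[ℂ] V) :
    ∃ N : ℕ, (S.tensorLowering ^ N) F = 0 := by
  refine eisensteinTensor_induction (P := fun F => ∃ N : ℕ, (S.tensorLowering ^ N) F = 0)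
    (fun v => ?_) (fun F G hF hG => ?_) (fun i F hF => ?_) F
  · obtain ⟨N, hN⟩ := S.L1_pow_apply_eq_zero v
    exact ⟨N, by rw [tensorLowering_pow_one_tmul, hN, TensorProduct.tmul_zero]⟩
  · obtain ⟨N, hN⟩ := hF
    obtain ⟨M, hM⟩ := hG
    exact ⟨max N M, by rw [map_add, pow_apply_eq_zero_of_le _ hN (le_max_left N M),
      pow_apply_eq_zero_of_le _ hM (le_max_right N M), add_zero]⟩
  · obtain ⟨N, hN⟩ := hF
    exact ⟨N + 1, by rw [tensorLowering_pow_X_smul, hN,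
      pow_apply_eq_zero_of_le _ hN (Nat.le_succ N), smul_zero, smul_zero, add_zero]⟩

/-- The invertible operator `exp(x Λ)` on `ℂ[E₂, E₄, E₆] ⊗ V`. -/
noncomputable def expLowering (x : ℂ) :
    MvPolynomial (Fin 3) ℂ ⊗[ℂ] V ≃ₗ[ℂ] MvPolynomial (Fin 3) ℂ ⊗[ℂ] V :=
  nilExp S.tensorLowering S.tensorLowering_pow_apply_eq_zero x

theorem expLowering_eq_sum (x : ℂ) {F : MvPolynomial (Fin 3) ℂ ⊗[ℂ] V} {N : ℕ}
    (h : (S.tensorLowering ^ N) F = 0) :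
    S.expLowering x F =
      ∑ n ∈ Finset.range N, (x ^ n / (n.factorial : ℂ)) • (S.tensorLowering ^ n) F :=
  nilExpFun_eq_sum _ x h

theorem expLowering_one_tmul (x : ℂ) (v : V) :
    S.expLowering x (1 ⊗ₜ v) = 1 ⊗ₜ S.expL1 x v := by
  obtain ⟨N, hN⟩ := S.L1_pow_apply_eq_zero v
  have h : (S.tensorLowering ^ N) (1 ⊗ₜ v) = 0 := by
    rw [tensorLowering_pow_one_tmul, hN, TensorProduct.tmul_zero]
  rw [S.expLowering_eq_sum x h, show S.expL1 x v = _ from nilExpFun_eq_sum _ x hN,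
    TensorProduct.tmul_sum]
  simp only [tensorLowering_pow_one_tmul, TensorProduct.tmul_smul]

/-- The exponential of the derivation `(12 / 2πi) ∂/∂E₂` is the shift `E₂ ↦ E₂ + (12 / 2πi) x`. -/
theorem expLowering_X_smul (x : ℂ) (i : Fin 3) (F : MvPolynomial (Fin 3) ℂ ⊗[ℂ] V) :
    S.expLowering x ((.X i : MvPolynomial (Fin 3) ℂ) • F) =
      (.X i + .C ((Pi.single 0 (e2Const * x) : Fin 3 → ℂ) i) : MvPolynomial (Fin 3) ℂ) •
        S.expLowering x F := by
  obtain ⟨N, hN⟩ := S.tensorLowering_pow_apply_eq_zero F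
  have hN1 := pow_apply_eq_zero_of_le _ hN (Nat.le_succ N)
  have h : (S.tensorLowering ^ (N + 1)) ((.X i : MvPolynomial (Fin 3) ℂ) • F) = 0 := by
    rw [tensorLowering_pow_X_smul, hN, hN1, smul_zero, smul_zero, add_zero]
  have hC (c : ℂ) (G : MvPolynomial (Fin 3) ℂ ⊗[ℂ] V) :
      (MvPolynomial.C c : MvPolynomial (Fin 3) ℂ) • G = c • G := by
    rw [← MvPolynomial.algebraMap_eq, algebraMap_smul]
  have hsingle : (Pi.single 0 (e2Const * x) : Fin 3 → ℂ) i =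
      x * (Pi.single 0 e2Const : Fin 3 → ℂ) i := by
    by_cases hi : i = 0
    · subst hi
      simp [mul_comm]
    · simp [hi]
  rw [S.expLowering_eq_sum x h, add_smul, hC, Finset.sum_range_succ']
  nth_rewrite 1 [S.expLowering_eq_sum x hN1]
  rw [S.expLowering_eq_sum x hN, Finset.sum_range_succ', smul_add, Finset.smul_sum,
    Finset.smul_sum, add_right_comm, ← Finset.sum_add_distrib]
  congr 1
  · refine Finset.sum_congr rfl fun n _ => ?_
    rw [tensorLowering_pow_X_smul, smul_add, smul_comm (.X i : MvPolynomial (Fin 3) ℂ), smul_smul,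
      smul_smul, hsingle]
    congr 2
    have h1 : (n.factorial : ℂ) ≠ 0 := by exact_mod_cast n.factorial_ne_zero
    have h2 : (n + 1 : ℂ) ≠ 0 := by exact_mod_cast n.succ_ne_zero
    rw [Nat.factorial_succ]
    push_cast
    field_simp
    ring
  · simp

/-- `exp(x Λ)` acts on `p ⊗ v` by `exp(x L(1))` on `v` and the shift `E₂ ↦ E₂ + (12 / 2πi) x`
on `p`. -/
theorem quasiModularEval_expLowering_tmul (x : ℂ) (p : MvPolynomial (Fin 3) ℂ) (v : V) (τ : ℍ) :
    quasiModularEval V (S.expLowering x (p ⊗ₜ v)) τ =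
      MvPolynomial.aeval (eisensteinPoint τ + Pi.single 0 (e2Const * x)) p • S.expL1 x v := by
  induction p using MvPolynomial.induction_on with
  | C a =>
    have : (MvPolynomial.C a : MvPolynomial (Fin 3) ℂ) ⊗ₜ[ℂ] v = a • (1 ⊗ₜ[ℂ] v) := by
      rw [TensorProduct.smul_tmul', MvPolynomial.smul_eq_C_mul, mul_one]
    rw [this, map_smul, expLowering_one_tmul, map_smul, Pi.smul_apply, quasiModularEval_tmul]
    simp
  | add p q hp hq => rw [TensorProduct.add_tmul, map_add, map_add, Pi.add_apply, hp, hq, map_add,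
      add_smul]
  | mul_X p i hp =>
    have : (p * .X i) ⊗ₜ[ℂ] v = (.X i : MvPolynomial (Fin 3) ℂ) • (p ⊗ₜ[ℂ] v) := by
      rw [TensorProduct.smul_tmul', smul_eq_mul, mul_comm]
    rw [this, expLowering_X_smul, quasiModularEval_smul, hp, smul_smul]
    simp [mul_comm]

theorem lowering_quasiModularEval (F : MvPolynomial (Fin 3) ℂ ⊗[ℂ] V) :
    S.lowering (quasiModularEval V F) = quasiModularEval V (S.tensorLowering F) :=
  quasiModularEval_injective.extend_apply _ _ F

theorem lowering_iterate_quasiModularEval (F : MvPolynomial (Fin 3) ℂ ⊗[ℂ] V) (n : ℕ) :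
    S.lowering^[n] (quasiModularEval V F) = quasiModularEval V ((S.tensorLowering ^ n) F) := by
  induction n with
  | zero => rfl
  | succ n ih =>
    rw [Function.iterate_succ_apply', ih, lowering_quasiModularEval, pow_succ',
      Module.End.mul_apply]

/-! ### The slash action in terms of `exp(X L(1))` -/

theorem L1_pow_mem_grade {k : ℤ} {a : V} (ha : a ∈ S.grade k) (n : ℕ) :
    (S.L1 ^ n) a ∈ S.grade (k - n) := by
  induction n with
  | zero => simpa using ha
  | succ n ih =>
    rw [pow_succ', Module.End.mul_apply, Nat.cast_succ, ← sub_sub]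
    exact S.L1_mem_grade ih

/-- Conjugation by `z^{L(0)}` scales `L(1)`, which lowers degrees by one, by `z⁻¹`. -/
theorem powL0Map_expL1 {z : ℂ} (hz : z ≠ 0) (x : ℂ) (v : V) :
    S.powL0Map z (S.expL1 (x * z) v) = S.expL1 x (S.powL0Map z v) := by
  refine S.grade_induction
    (p := fun v => S.powL0Map z (S.expL1 (x * z) v) = S.expL1 x (S.powL0Map z v))
    (by simp) (fun v w hv hw => by simp only [map_add, hv, hw]) (fun k a ha => ?_) v
  obtain ⟨N, hN⟩ := S.L1_pow_apply_eq_zero a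
  rw [S.powL0Map_of_mem z ha, map_smul, show S.expL1 (x * z) a = _ from nilExpFun_eq_sum _ _ hN,
    show S.expL1 x a = _ from nilExpFun_eq_sum _ _ hN, map_sum, Finset.smul_sum]
  refine Finset.sum_congr rfl fun n _ => ?_
  rw [map_smul, S.powL0Map_of_mem z (S.L1_pow_mem_grade ha n), smul_smul, smul_smul,
    zpow_sub₀ hz, zpow_natCast, mul_pow]
  congr 1
  field_simp

theorem slash_eq_expL1 (k : ℤ) (f : ℍ → V) (γ : SL(2, ℤ)) (τ : ℍ) :
    S.slash k f γ τ = S.expL1 (cocycleX γ τ)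
      (autFactor γ τ ^ (-k) • S.powL0Map (autFactor γ τ ^ (2 : ℤ)) (f (γ • τ))) := by
  have hj := autFactor_ne_zero γ τ
  rw [map_smul, ← S.powL0Map_expL1 (zpow_ne_zero 2 hj)]
  have h1 : cocycleX γ τ * autFactor γ τ ^ (2 : ℤ) = -(-((γ 1 0 : ℂ) * autFactor γ τ)) := by
    rw [cocycleX]
    field_simp
  have h2 : autFactor γ τ ^ (2 : ℤ) = ((autUnit γ τ ^ (-2 : ℤ))⁻¹ : ℂˣ) := by
    simp [autUnit]
  rw [h1, h2]
  rfl

theorem slash_sum {ι : Type*} (s : Finset ι) (k : ℤ) (f : ι → ℍ → V) (γ : SL(2, ℤ)) (τ : ℍ) :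
    S.slash k (∑ i ∈ s, f i) γ τ = ∑ i ∈ s, S.slash k (f i) γ τ := by
  simp only [slash_eq_expL1, Finset.sum_apply, map_sum, map_smul, Finset.smul_sum]

/-- `f ‖_k γ = exp(X Λ) f` for `f = p(E₂, E₄, E₆) v` of total weight `k`, where `v` of degree `n`
counts with weight `2n`. -/
theorem slash_quasiModularEval_tmul {k n w : ℤ} (hw : w = k - 2 * n)
    {p : MvPolynomial (Fin 3) ℂ} (hp : p.IsWeightedHomogeneous eisensteinWeight w) {v : V}
    (hv : v ∈ S.grade n) (γ : SL(2, ℤ)) (τ : ℍ) :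
    S.slash k (quasiModularEval V (p ⊗ₜ v)) γ τ =
      quasiModularEval V (S.expLowering (cocycleX γ τ) (p ⊗ₜ v)) τ := by
  have hj := autFactor_ne_zero γ τ
  rw [slash_eq_expL1, quasiModularEval_expLowering_tmul, quasiModularEval_tmul,
    map_smul (S.powL0Map _), S.powL0Map_of_mem _ hv, aeval_eisensteinPoint_smul hp, smul_smul,
    smul_smul, map_smul]
  congr 1
  have : autFactor γ τ ^ (-k) * (autFactor γ τ ^ w * (autFactor γ τ ^ (2 : ℤ)) ^ n) = 1 := by
    rw [← zpow_mul, ← zpow_add₀ hj, ← zpow_add₀ hj, hw]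
    convert zpow_zero _
    ring
  linear_combination MvPolynomial.aeval
    (eisensteinPoint τ + Pi.single 0 (e2Const * cocycleX γ τ)) p * this

/-! ### Coordinates of vector-valued quasi-modular forms -/

/-- The projection of `V` onto the graded piece `V_n`. -/
noncomputable def gradeProj (n : ℤ) : V →ₗ[ℂ] S.grade n :=
  DirectSum.component ℂ ℤ (fun k => S.grade k) n ∘ₗ S.gradeEquiv.symm.toLinearMap

theorem gradeProj_of_mem {n : ℤ} {v : V} (hv : v ∈ S.grade n) : S.gradeProj n v = ⟨v, hv⟩ := by
  rw [gradeProj, LinearMap.comp_apply, LinearEquiv.coe_coe, S.gradeEquiv_symm_of_mem hv,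
    DirectSum.component.lof_self]

theorem gradeProj_of_mem_ne {m n : ℤ} (h : m ≠ n) {v : V} (hv : v ∈ S.grade m) :
    S.gradeProj n v = 0 := by
  rw [gradeProj, LinearMap.comp_apply, LinearEquiv.coe_coe, S.gradeEquiv_symm_of_mem hv,
    DirectSum.component.of, dif_neg h]

theorem gradeProj_powL0Map (z : ℂ) (n : ℤ) (v : V) :
    S.gradeProj n (S.powL0Map z v) = z ^ n • S.gradeProj n v := by
  refine S.grade_induction
    (p := fun v => S.gradeProj n (S.powL0Map z v) = z ^ n • S.gradeProj n v)
    (by simp) (fun v w hv hw => by simp only [map_add, smul_add, hv, hw]) (fun k a ha => ?_) v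
  rw [S.powL0Map_of_mem z ha, map_smul]
  by_cases h : k = n
  · rw [h]
  · rw [S.gradeProj_of_mem_ne h ha, smul_zero, smul_zero]

theorem exists_sum_gradeProj (N : ℤ) :
    ∃ A : Finset ℤ, ∀ v ∈ S.truncation N, ∑ n ∈ A, (S.gradeProj n v : V) = v := by
  obtain ⟨n₀, hn₀⟩ := S.exists_grade_eq_bot
  refine ⟨Finset.Icc n₀ N, fun v hv => ?_⟩
  have hle : S.truncation N ≤ LinearMap.eqLocus
      (∑ n ∈ Finset.Icc n₀ N, (S.grade n).subtype ∘ₗ S.gradeProj n) LinearMap.id := by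
    refine iSup₂_le fun m hm a ha => ?_
    rw [LinearMap.mem_eqLocus, LinearMap.sum_apply, LinearMap.id_apply]
    rcases lt_or_ge m n₀ with h | h
    · rw [hn₀ m h, Submodule.mem_bot] at ha
      simp [ha]
    · rw [Finset.sum_eq_single m]
      · simp [S.gradeProj_of_mem ha]
      · intro n _ hn
        simp [S.gradeProj_of_mem_ne hn.symm ha]
      · intro hcon
        exact absurd (Finset.mem_Icc.mpr ⟨h, hm⟩) hcon
  simpa [LinearMap.mem_eqLocus, LinearMap.sum_apply] using hle hv

theorem exists_L1_pow_eq_zero (N : ℤ) : ∃ M : ℕ, ∀ v ∈ S.truncation N, (S.L1 ^ M) v = 0 := by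
  obtain ⟨n₀, hn₀⟩ := S.exists_grade_eq_bot
  refine ⟨(N - n₀ + 1).toNat, fun v hv => ?_⟩
  have hle : S.truncation N ≤ LinearMap.ker (S.L1 ^ (N - n₀ + 1).toNat) := by
    refine iSup₂_le fun m hm a ha => ?_
    have := S.L1_pow_mem_grade ha (N - n₀ + 1).toNat
    rwa [hn₀ _ (by omega), Submodule.mem_bot] at this
  exact hle hv

theorem IsHolomorphicAtCusp.isBoundedAtImInfty {S : QVOA V} {N : ℤ} {f : ℍ → V}
    (hf : S.IsHolomorphicAtCusp N f) (φ : Module.Dual ℂ V) :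
    IsBoundedAtImInfty fun τ => φ (f τ) := by
  obtain ⟨a, -, ha⟩ := hf
  refine isBoundedAtImInfty_of_hasSum_qExpansion (h := 1) (c := fun n => φ (a n)) one_pos
    fun τ => ?_
  simpa [Function.Periodic.qParam] using ha φ τ

/-- A coordinate in degree `n` of a `V`-valued quasi-modular form of weight `k` is a scalar
quasi-modular form of weight `k - 2n`, as `exp(-X L(1))` turns the transformation law of `f` into
one for `j^{2L(0)} f(γτ)`. -/
theorem exists_isScalarQuasiModular {k N : ℤ} {s : ℕ} {f : ℍ → V} {Q : ℕ → ℍ → V}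
    (hQ : ∀ n ≤ s, S.IsHolomorphic N (Q n) ∧ S.IsHolomorphicAtCusp N (Q n))
    (hlaw : S.HasQuasiModularLaw k f s Q) (n : ℤ) (ψ : Module.Dual ℂ (S.grade n)) :
    ∃ (t : ℕ) (q : ℕ → ℍ → ℂ), IsScalarQuasiModular (k - 2 * n) t
        (fun τ => ψ (S.gradeProj n (f τ))) q ∧
      ∀ r, MDifferentiable 𝓘(ℂ) 𝓘(ℂ) (q r) ∧ IsBoundedAtImInfty (q r) := by
  obtain ⟨M, hM⟩ := S.exists_L1_pow_eq_zero N
  -- `q r` collects the terms `(-X)ˡ / l! · Xᵐ · ψ(L(1)ˡ Q_m)` of `exp(-X L(1)) ∑ Xᵐ Q_m` with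
  -- `l + m = r`.
  let φ (l : ℕ) : Module.Dual ℂ V := ψ ∘ₗ S.gradeProj n ∘ₗ (S.L1 ^ l)
  let I : Finset (ℕ × ℕ) := Finset.range M ×ˢ Finset.range (s + 1)
  let c (l : ℕ) : ℂ := (-1) ^ l / (l.factorial : ℂ)
  let q (r : ℕ) : ℍ → ℂ :=
    ∑ x ∈ I with x.1 + x.2 = r, c x.1 • fun τ => φ x.1 (Q x.2 τ)
  have hI (x : ℕ × ℕ) (hx : x ∈ I) : x.2 ≤ s :=
    Nat.lt_succ_iff.mp (Finset.mem_range.mp (Finset.mem_product.mp hx).2)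
  refine ⟨M + s, q, fun γ τ => ?_, fun r => ⟨?_, ?_⟩⟩
  · have hj := autFactor_ne_zero γ τ
    set X := cocycleX γ τ
    have h := hlaw γ τ
    rw [slash_eq_expL1, ← LinearEquiv.eq_symm_apply] at h
    have hmem : ∑ m ∈ Finset.range (s + 1), X ^ m • Q m τ ∈ S.truncation N :=
      Submodule.sum_mem _ fun m hm => Submodule.smul_mem _ _
        ((hQ m (Nat.lt_succ_iff.mp (Finset.mem_range.mp hm))).1.1 τ)
    have hexp : (S.expL1 X).symm (∑ m ∈ Finset.range (s + 1), X ^ m • Q m τ) = _ :=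
      nilExpFun_eq_sum _ (-X) (hM _ hmem)
    rw [hexp] at h
    have h1 := congrArg (fun v => ψ (S.gradeProj n v)) h
    simp only [map_smul, gradeProj_powL0Map, map_sum, smul_eq_mul] at h1
    have h2 : ∑ r ∈ Finset.range (M + s + 1), X ^ r * q r τ =
        ∑ x ∈ I, X ^ (x.1 + x.2) * (c x.1 * φ x.1 (Q x.2 τ)) := by
      rw [← Finset.sum_fiberwise_of_maps_to (s := I) (t := Finset.range (M + s + 1))
        (g := fun x => x.1 + x.2)]
      · refine Finset.sum_congr rfl fun r _ => ?_
        simp only [q, Finset.sum_apply, Finset.mul_sum]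
        refine Finset.sum_congr rfl fun x hx => ?_
        rw [(Finset.mem_filter.mp hx).2]
        rfl
      · intro x hx
        have h3 := Finset.mem_range.mp (Finset.mem_product.mp hx).1
        have h4 := hI x hx
        exact Finset.mem_range.mpr (by omega)
    have h3 : ∑ l ∈ Finset.range M, (-X) ^ l / (l.factorial : ℂ) *
        ∑ m ∈ Finset.range (s + 1), X ^ m * ψ (S.gradeProj n ((S.L1 ^ l) (Q m τ))) =
        ∑ x ∈ I, X ^ (x.1 + x.2) * (c x.1 * φ x.1 (Q x.2 τ)) := by
      rw [Finset.sum_product]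
      refine Finset.sum_congr rfl fun l _ => ?_
      rw [Finset.mul_sum]
      refine Finset.sum_congr rfl fun m _ => ?_
      simp only [c, φ, LinearMap.comp_apply, pow_add]
      rw [neg_pow]
      ring
    rw [h2, ← h3, ← h1, ← mul_assoc, ← mul_assoc, ← zpow_mul, ← zpow_add₀ hj, ← zpow_add₀ hj]
    have h4 : k - 2 * n + -k + 2 * n = 0 := by ring
    rw [h4, zpow_zero, one_mul]
  · refine MDifferentiable.sum fun x hx => MDifferentiable.const_smul _ ?_
    exact (hQ x.2 (hI x (Finset.mem_filter.mp hx).1)).1.2 (φ x.1)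
  · refine (boundedAtImInftySubalgebra ℂ).sum_mem fun x hx => ?_
    refine (boundedAtImInftySubalgebra ℂ).smul_mem ?_ _
    exact (hQ x.2 (hI x (Finset.mem_filter.mp hx).1)).2.isBoundedAtImInfty (φ x.1)

/-- A `V`-valued quasi-modular form is a polynomial in `E₂, E₄, E₆` with coefficients in `V`, and
`f ‖_k γ = exp(X Λ) f`. -/
theorem exists_quasiModularEval_eq {k : ℤ} {f : ℍ → V} (hf : f ∈ S.quasiModularForms k) :
    ∃ F : MvPolynomial (Fin 3) ℂ ⊗[ℂ] V, quasiModularEval V F = f ∧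
      ∀ (γ : SL(2, ℤ)) (τ : ℍ), S.slash k f γ τ =
        quasiModularEval V (S.expLowering (cocycleX γ τ) F) τ := by
  obtain ⟨N, s, Q, hol, -, hQ, hlaw⟩ := hf
  have := S.finiteDimensional
  obtain ⟨A, hA⟩ := S.exists_sum_gradeProj N
  let b (n : ℤ) := Module.finBasis ℂ (S.grade n)
  have hp (n : ℤ) (i) : ∃ p : MvPolynomial (Fin 3) ℂ,
      p.IsWeightedHomogeneous eisensteinWeight (k - 2 * n) ∧
      ∀ τ, (b n).coord i (S.gradeProj n (f τ)) = MvPolynomial.aeval (eisensteinPoint τ) p := by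
    obtain ⟨t, q, hq, hgood⟩ := S.exists_isScalarQuasiModular hQ hlaw n ((b n).coord i)
    exact hq.exists_aeval_eisensteinPoint (fun r _ => (hgood r).1) fun r _ => (hgood r).2
  choose p hpw hpf using hp
  have hF : f = ∑ n ∈ A, ∑ i, quasiModularEval V (p n i ⊗ₜ (b n i : V)) := by
    funext τ
    rw [← hA _ (hol.1 τ)]
    simp only [Finset.sum_apply, quasiModularEval_tmul, ← hpf]
    refine Finset.sum_congr rfl fun n _ => ?_
    have := congrArg (S.grade n).subtype ((b n).sum_repr (S.gradeProj n (f τ)))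
    rw [map_sum] at this
    exact this.symm
  refine ⟨∑ n ∈ A, ∑ i, p n i ⊗ₜ (b n i : V), by simp only [map_sum, hF], fun γ τ => ?_⟩
  rw [hF]
  simp only [map_sum, Finset.sum_apply, slash_sum]
  exact Finset.sum_congr rfl fun n _ => Finset.sum_congr rfl fun i _ =>
    S.slash_quasiModularEval_tmul rfl (hpw n i) (b n i).2 γ τ

end QVOA

end Tensor

theorem mainTheorem2 {V : Type*} [AddCommGroup V] [Module ℂ V] (S : QVOA V) (k : ℤ)
    (f : ℍ → V) (hf : f ∈ S.quasiModularForms k) :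
    -- `f` is a polynomial in `E₂, E₄, E₆` with coefficients in `V`, in exactly one way,
    -- so that `Λ f` is meaningful
    (∃! F : MvPolynomial (Fin 3) ℂ ⊗[ℂ] V, quasiModularEval V F = f) ∧
    -- `f ‖_k γ = exp(X Λ) f`, a finite sum
    (∃ s : ℕ, (∀ n > s, S.lowering^[n] f = 0) ∧
      ∀ (γ : SL(2, ℤ)) (τ : ℍ), S.slash k f γ τ =
        ∑ n ∈ Finset.range (s + 1),
          (cocycleX γ τ ^ n / (n.factorial : ℂ)) • (S.lowering^[n] f) τ) ∧
    -- every family of coefficients in the transformation law of `f` is given by `Λⁿ f / n!`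
    (∀ (s : ℕ) (Q : ℕ → ℍ → V), (∀ n > s, Q n = 0) → S.HasQuasiModularLaw k f s Q →
      ∀ n, Q n = (n.factorial : ℂ)⁻¹ • S.lowering^[n] f) := by
  obtain ⟨F, hF, hslash⟩ := S.exists_quasiModularEval_eq hf
  obtain ⟨N, hN⟩ := S.tensorLowering_pow_apply_eq_zero F
  have hiter (n : ℕ) : S.lowering^[n] f = quasiModularEval V ((S.tensorLowering ^ n) F) :=
    hF ▸ S.lowering_iterate_quasiModularEval F n
  have hzero (n : ℕ) (hn : N ≤ n) : S.lowering^[n] f = 0 := by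
    rw [hiter, pow_apply_eq_zero_of_le _ hN hn, map_zero]
  have hexp (K : ℕ) (hK : N ≤ K) (γ : SL(2, ℤ)) (τ : ℍ) : S.slash k f γ τ =
      ∑ n ∈ Finset.range K, (cocycleX γ τ ^ n / (n.factorial : ℂ)) • (S.lowering^[n] f) τ := by
    rw [hslash, S.expLowering_eq_sum _ (pow_apply_eq_zero_of_le _ hN hK), map_sum,
      Finset.sum_apply]
    refine Finset.sum_congr rfl fun n _ => ?_
    rw [map_smul, hiter, Pi.smul_apply]
  refine ⟨⟨F, hF, fun G hG => quasiModularEval_injective (hG.trans hF.symm)⟩,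
    ⟨N, fun n hn => hzero n hn.le, hexp (N + 1) N.le_succ⟩, fun s Q hQ hlaw n => ?_⟩
  rcases lt_or_ge n (s + 1 + N) with hn | hn
  · funext τ
    rw [← sub_eq_zero]
    refine eq_zero_of_sum_cocycleX_pow_smul_eq_zero (τ := τ) (N := s + 1 + N)
      (a := fun n => Q n τ - ((n.factorial : ℂ)⁻¹ • S.lowering^[n] f) τ) (fun γ => ?_) hn
    have hlaw' : S.slash k f γ τ = ∑ n ∈ Finset.range (s + 1 + N), cocycleX γ τ ^ n • Q n τ := by
      rw [hlaw γ τ]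
      refine Finset.sum_subset (Finset.range_mono (Nat.le_add_right _ _)) fun m _ hm => ?_
      rw [hQ m (by simpa using hm), Pi.zero_apply, smul_zero]
    simp only [smul_sub, Finset.sum_sub_distrib, Pi.smul_apply, smul_smul, ← div_eq_mul_inv]
    rw [← hlaw', ← hexp _ (Nat.le_add_left N _), sub_self]
  · rw [hQ n (by omega), hzero n (by omega), smul_zero]
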